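/- **Protocol.** Bit strings are vectors over $\mathbf F_2$, $|\cdot|$ is Hamming weight and $d_H$ Hamming distance. The protocol BB84-INFO-$z$ has public parameters $n,n_z,n_x\ge 1$ (put $N=n+n_z+n_x$), thresholds $p_{a,z},p_{a,x}>0$, an $r\times n$ parity-check matrix $P_C$ and an $m\times n$ matrix $P_K$ over $\mathbf F_2$ ($m\ge 1$) whose rows $v_1,\dots,v_r$ and $v_{r+1},\dots,v_{r+m}$ are together linearly independent, and a decoding function $D:\mathbf F_2^n\times\mathbf F_2^r\to\mathbf F_2^n$. Let $V_l=\operatorname{Span}\{v_1,\dots,v_l\}$ and $d_{r,m}=\min_{r\le l<r+m}d_H(v_{l+1},V_l)$. Alice chooses uniformly at random a partition $\mathcal P=(\mathbf s,\mathbf z,\mathbf b)$ of the $N$ positions (strings in $\mathbf F_2^N$ with $|\mathbf s|=n$, $|\mathbf z|=n_z$, $|\mathbf b|=n_x$, $|\mathbf s+\mathbf z+\mathbf b|=N$) and, independently, a uniform $\mathbf i\in\mathbf F_2^N$, and sends the qubits $|i_j^{b_j}\rangle$, where $|0^0\rangle,|1^0\rangle$ is the computational ($z$) basis and $|0^1\rangle,|1^1\rangle=(|0^0\rangle\pm|1^0\rangle)/\sqrt2$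 the $x$ basis. In a *collective attack*, chosen in advance, Eve attaches to each qubit $j$ a separate (finite-dimensional) probe in a fixed unit vector and applies a unitary $U_j$ to probe and qubit; she keeps the probe and forwards the qubit. Bob measures qubit $j$ in the basis $b_j$, obtaining $\mathbf i^B$. Let $\mathbf c=\mathbf i+\mathbf i^B$, and let a subscript $\mathbf s,\mathbf z,\mathbf b$ denote the substring on the positions where that string is $1$. The test is passed ($\mathbf T=1$) if $|\mathbf c_{\mathbf z}|/n_z\le p_{a,z}$ and $|\mathbf c_{\mathbf b}|/n_x\le p_{a,x}$; otherwise the protocol aborts. With $\mathbf x=\mathbf i_{\mathbf s}$ and $\mathbf x^B=\mathbf i^B_{\mathbf s}$, Alice announces $\boldsymbol\xi=\mathbf xP_C^{T}$; her final key is $\mathbf k=\mathbf xP_K^{T}$, and Bob's is $\mathbf k'=D(\mathbf x^B,\boldsymbol\xi)P_K^{T}$. Put $$\rho_{ABE}=\sum_{\mathbf i,\mathbf i^B,\mathcal P\,:\,\mathbf T=1}P(\mathbf i,\mathbf i^B,\mathcal P)\;|\mathbf k\rangle\langle\mathbf k|_A\otimes|\mathbf k'\rangle\langle\mathbf k'|_B\otimes\rho^{E}_{\mathbf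 i,\mathbf i^B,\mathcal P}\otimes|\mathbf w\rangle\langle\mathbf w|,$$ where $\rho^E_{\mathbf i,\mathbf i^B,\mathcal P}$ is the state of Eve's probes given $\mathbf i,\mathbf i^B,\mathcal P$, and $\mathbf w=(\mathbf i_{\mathbf z},\mathbf i_{\mathbf b},\mathbf i^B_{\mathbf z},\mathbf i^B_{\mathbf b},\mathcal P,\boldsymbol\xi)$ is the published information (both of these belong to Eve's system). Put $\rho_U=2^{-m}\sum_{\mathbf k}|\mathbf k\rangle\langle\mathbf k|_A\otimes|\mathbf k\rangle\langle\mathbf k|_B$ and $\rho_E=\operatorname{tr}_{AB}\rho_{ABE}$. **Theorem.** Let $\delta,R>0$, and let there be given, for every $n$ in a set $S$ of positive integers (for instance, an infinite one), matrices $P_C$ ($r_n\times n$) and $P_K$ ($m_n\times n$) as above, with $\delta<d_{r_n,m_n}/n$ and $m_n/n\le R$. Let $p_{a,z},p_{a,x},\epsilon_{\rm sec},\epsilon_{\rm rel}>0$ with $p_{a,x}+\epsilon_{\rm sec}\le\delta/2$. Suppose that for every $n\in S$ the code can correct $n(p_{a,z}+\epsilon_{\rm rel})$ errors: $D(\mathbf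 x^B,\mathbf xP_C^{T})=\mathbf x$ whenever $d_H(\mathbf x,\mathbf x^B)\le n(p_{a,z}+\epsilon_{\rm rel})$. Then: 1. For every $n\in S$, all $n_z,n_x\ge1$ and every collective attack, $$\tfrac12\operatorname{tr}\left|\rho_{ABE}-\rho_U\otimes\rho_E\right|\le e^{-2\left(\frac{n_z}{n+n_z}\right)^2n\epsilon_{\rm rel}^2}+2R\,n\,e^{-\left(\frac{n_x}{n+n_x}\right)^2n\epsilon_{\rm sec}^2}.$$ 2. This bound is exponentially small in $n$ when the numbers of test bits are at least proportional to $n$, so the protocol is composably secure: for every $c>0$ there are $C,\kappa>0$ such that the right-hand side is at most $Ce^{-\kappa n}$ for all $n,n_z,n_x\ge1$ with $n_z,n_x\ge cn$; hence, for $n\in S$ and such $n_z,n_x$, $\tfrac12\operatorname{tr}|\rho_{ABE}-\rho_U\otimes\rho_E|\le Ce^{-\kappa n}$ for every collective attack. -/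

import Mathlib

open scoped Kronecker MatrixOrder Matrix

noncomputable section

namespace BB84InfoZ

/-! ### Bit strings, codes and partitions -/

/-- Bit strings of length `t`, i.e. the vector space `F_2^t`. -/
abbrev Bits (t : ℕ) : Type := Fin t → ZMod 2

/-- The public coding data for `n` INFO bits: the parity-check matrix `PC` (with `r` rows), the
privacy-amplification matrix `PK` (with `m` rows), and the procedure `dec` by which Bob turns his
INFO string and the syndrome announced by Alice into an estimate of Alice's INFO string. -/
structure Code (n : ℕ) where
  r : ℕ
  m : ℕ
  PC : Matrix (Fin r) (Fin n) (ZMod 2)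
  PK : Matrix (Fin m) (Fin n) (ZMod 2)
  dec : Bits n → Bits r → Bits n

namespace Code

variable {n : ℕ} (K : Code n)

/-- The rows `v_1, …, v_r` of `PC` followed by the rows `v_{r+1}, …, v_{r+m}` of `PK`
(indexed from `0`). -/
def rows : Fin (K.r + K.m) → Bits n :=
  Fin.append (fun a => K.PC a) (fun a => K.PK a)

/-- The span of the first `l` rows. -/
def rowSpan (l : ℕ) : Submodule (ZMod 2) (Bits n) :=
  Submodule.span (ZMod 2) (K.rows '' {a | (a : ℕ) < l})

/-- `d_{r,m}`: the minimum over the rows of `PK` of the Hamming distance between that row and the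
span of all the rows preceding it. (For `m = 0` the minimum is over the empty set; the value is
then `0`.) -/
def dist : ℕ :=
  sInf {d : ℕ | ∃ l : Fin (K.r + K.m), K.r ≤ (l : ℕ) ∧
    ∃ w ∈ K.rowSpan l, d = hammingDist (K.rows l) w}

/-- The syndrome `ξ = x PCᵀ`. -/
def syndrome (x : Bits n) : Bits K.r := x ᵥ* K.PCᵀ

/-- The key-generation function `k = x PKᵀ`. -/
def key (x : Bits n) : Bits K.m := x ᵥ* K.PKᵀ

/-- Bob's final key, computed from his INFO string and Alice's syndrome. -/
def bobKey (xB : Bits n) (ξ : Bits K.r) : Bits K.m := K.key (K.dec xB ξ)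

/-- Error correction recovers Alice's string whenever there are at most `t` errors. -/
def CorrectsErrors (t : ℝ) : Prop :=
  ∀ x xB : Bits n, (hammingDist x xB : ℝ) ≤ t → K.dec xB (K.syndrome x) = x

end Code

/-- The partitions `(s, z, b)` of the `N = n + nz + nx` positions into `n` INFO, `nz` TEST-Z and
`nx` TEST-X positions, given by three `N`-bit strings. -/
abbrev Partition (n nz nx : ℕ) : Type :=
  {P : Bits (n + nz + nx) × Bits (n + nz + nx) × Bits (n + nz + nx) //
    hammingNorm P.1 = n ∧ hammingNorm P.2.1 = nz ∧ hammingNorm P.2.2 = nx ∧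
      hammingNorm (P.1 + P.2.1 + P.2.2) = n + nz + nx}

instance (n nz nx : ℕ) : DecidableEq (Partition n nz nx) := inferInstance

/-- The substring of `i` on the positions where `s` is `1`, in increasing order. -/
def substring {N k : ℕ} (s : Bits N) (hs : hammingNorm s = k) (i : Bits N) : Bits k :=
  fun a => i ((Finset.univ.filter fun j => s j ≠ 0).orderEmbOfFin hs a)

namespace Partition

variable {n nz nx : ℕ} (P : Partition n nz nx)

/-- The string `b` of bases: `0` for the `z` basis, `1` for the `x` basis. -/
def bases : Bits (n + nz + nx) := P.1.2.2

/-- The INFO substring. -/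
def info (i : Bits (n + nz + nx)) : Bits n := substring P.1.1 P.2.1 i

/-- The TEST-Z substring. -/
def testZ (i : Bits (n + nz + nx)) : Bits nz := substring P.1.2.1 P.2.2.1 i

/-- The TEST-X substring. -/
def testX (i : Bits (n + nz + nx)) : Bits nx := substring P.1.2.2 P.2.2.2.1 i

/-- The test `T = 1`: the error rates on the TEST-Z and TEST-X bits do not exceed `pz`, `px`. -/
def TestPassed (pz px : ℝ) (i iB : Bits (n + nz + nx)) : Prop :=
  (hammingNorm (P.testZ (i + iB)) : ℝ) / nz ≤ pz ∧
    (hammingNorm (P.testX (i + iB)) : ℝ) / nx ≤ px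

end Partition

/-! ### Qubits and collective attacks -/

/-- Coordinates, in the computational basis, of the qubit state `|i^b⟩`: the `z` basis for `b = 0`
and the `x` basis `(|0⟩ ± |1⟩)/√2` for `b = 1`. -/
def ket (b i : ZMod 2) : ZMod 2 → ℂ := fun t =>
  if b = 0 then (if t = i then 1 else 0)
  else (if i = 1 ∧ t = 1 then -1 else 1) / (Real.sqrt 2 : ℂ)

/-- A collective attack on `N` qubits: for each qubit `j` a probe with state space `ℂ^(dim j)`,
its initial unit vector, and a unitary operator on the probe together with the qubit. -/
structure CollectiveAttack (N : ℕ) where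
  dim : Fin N → ℕ
  init : ∀ j, Fin (dim j) → ℂ
  init_unit : ∀ j, ∑ e, ‖init j e‖ ^ 2 = 1
  U : ∀ j, Matrix.unitaryGroup (Fin (dim j) × ZMod 2) ℂ

namespace CollectiveAttack

variable {N : ℕ} (𝒜 : CollectiveAttack N)

/-- Basis labels of the joint system of all the probes. -/
abbrev Probe : Type := ∀ j, Fin (𝒜.dim j)

/-- The joint state `U_j |0^E⟩|i^b⟩` of the `j`-th probe and the `j`-th qubit after the attack. -/
def afterAttack (j : Fin N) (b i : ZMod 2) : Fin (𝒜.dim j) × ZMod 2 → ℂ :=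
  (𝒜.U j : Matrix (Fin (𝒜.dim j) × ZMod 2) (Fin (𝒜.dim j) × ZMod 2) ℂ) *ᵥ
    fun et => 𝒜.init j et.1 * ket b i et.2

/-- The non-normalized probe vector `|E^b_{i,i'}⟩ = (1 ⊗ ⟨i'^b|) U_j |0^E⟩|i^b⟩`. -/
def probeVec (j : Fin N) (b i i' : ZMod 2) : Fin (𝒜.dim j) → ℂ :=
  fun e => ∑ t, star (ket b i' t) * 𝒜.afterAttack j b i (e, t)

/-- The non-normalized joint vector `⨂_j |E^{b_j}_{i_j, iB_j}⟩` of all the probes when Alice sends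
`i` in the bases `b` and Bob measures `iB` in the same bases. -/
def eveVec (b i iB : Bits N) : 𝒜.Probe → ℂ :=
  fun e => ∏ j, 𝒜.probeVec j (b j) (i j) (iB j) (e j)

/-- The probability that Bob measures `iB` when Alice sends `i`, both using the bases `b`. -/
def outcomeProb (b i iB : Bits N) : ℝ := ∑ e, ‖𝒜.eveVec b i iB e‖ ^ 2

/-- Eve's normalized state when Alice sends `i` and Bob measures `iB`, both using the bases `b`.
(It is `0` in the case of an outcome of probability `0`.) -/
def eveState (b i iB : Bits N) : Matrix 𝒜.Probe 𝒜.Probe ℂ :=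
  ((𝒜.outcomeProb b i iB)⁻¹ : ℂ) •
    Matrix.vecMulVec (𝒜.eveVec b i iB) (star (𝒜.eveVec b i iB))

end CollectiveAttack

/-! ### The final state of the protocol -/

/-- The projector `|a⟩⟨a|` onto a basis state. -/
def proj {α : Type*} [DecidableEq α] (a : α) : Matrix α α ℂ := Matrix.single a a 1

/-- The partial trace over the first subsystem. -/
def partialTraceLeft {α β : Type*} [Fintype α] (M : Matrix (α × β) (α × β) ℂ) : Matrix β β ℂ :=
  fun e e' => ∑ a, M (a, e) (a, e')

/-- The trace distance `½ tr |M - M'|`, where `|A| = √(A† A)`. -/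
def traceDist {α : Type*} [Fintype α] [DecidableEq α] (M M' : Matrix α α ℂ) : ℝ :=
  (1 / 2) * (Matrix.trace (CFC.abs (M - M'))).re

section State

variable {n : ℕ} (K : Code n) (nz nx : ℕ) (pz px : ℝ) (𝒜 : CollectiveAttack (n + nz + nx))

/-- What is published on the classical channel: Alice's TEST-Z and TEST-X bits, Bob's TEST-Z and
TEST-X bits, the partition, and the syndrome. -/
abbrev Public : Type :=
  (Bits nz × Bits nx × Bits nz × Bits nx) × Partition n nz nx × Bits K.r

instance : DecidableEq (Public K nz nx) :=
  have : DecidableEq (Bits nz × Bits nx × Bits nz × Bits nx) := inferInstance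
  have : DecidableEq (Partition n nz nx × Bits K.r) := inferInstance
  instDecidableEqProd

/-- The published information in a given run. -/
def published (P : Partition n nz nx) (i iB : Bits (n + nz + nx)) : Public K nz nx :=
  ((P.testZ i, P.testX i, P.testZ iB, P.testX iB), P, K.syndrome (P.info i))

/-- `P(i, iB, 𝒫)`: the partition and the string `i` are uniform and independent, and `iB` is the
outcome of Bob's measurement. -/
def jointProb (i iB : Bits (n + nz + nx)) (P : Partition n nz nx) : ℝ :=
  (1 / (Fintype.card (Partition n nz nx) : ℝ)) * (1 / 2 ^ (n + nz + nx)) *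
    𝒜.outcomeProb P.bases i iB

open scoped Classical in
/-- The final (sub-normalized) state `ρ_ABE`: the sum over all runs in which the test is passed.
Systems `A`, `B` hold the final keys; `E` consists of the probes and the published information. -/
def rhoABE : Matrix ((Bits K.m × Bits K.m) × (𝒜.Probe × Public K nz nx))
    ((Bits K.m × Bits K.m) × (𝒜.Probe × Public K nz nx)) ℂ :=
  ∑ P : Partition n nz nx, ∑ i : Bits (n + nz + nx), ∑ iB : Bits (n + nz + nx),
    if P.TestPassed pz px i iB then
      (jointProb nz nx 𝒜 i iB P : ℂ) •
        ((proj (K.key (P.info i)) ⊗ₖ proj (K.bobKey (P.info iB) (K.syndrome (P.info i)))) ⊗ₖ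
          (𝒜.eveState P.bases i iB ⊗ₖ proj (published K nz nx P i iB)))
    else 0

/-- `ρ_U`: the uniform mixture of all the pairs of identical keys. -/
def rhoU : Matrix (Bits K.m × Bits K.m) (Bits K.m × Bits K.m) ℂ :=
  (1 / 2 ^ K.m : ℂ) • ∑ k : Bits K.m, proj k ⊗ₖ proj k

/-- `ρ_E = tr_AB ρ_ABE`. -/
def rhoE : Matrix (𝒜.Probe × Public K nz nx) (𝒜.Probe × Public K nz nx) ℂ :=
  partialTraceLeft (rhoABE K nz nx pz px 𝒜)

/-- `½ tr |ρ_ABE - ρ_U ⊗ ρ_E|`. -/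
def distanceFromIdeal : ℝ :=
  traceDist (rhoABE K nz nx pz px 𝒜) (rhoU K ⊗ₖ rhoE K nz nx pz px 𝒜)

end State

end BB84InfoZ

end

/-!
In a collective attack the law `errDist b` of the error string depends only on the basis string `b`,
and, given `b`, the INFO positions are a random sample of the positions measured in the same basis.
Both terms of the bound come from Hoeffding's inequality for sampling without replacement.

Reliability: the keys of Alice and Bob differ only if the INFO bits carry more than
`n * (pz + εrel)` errors although the TEST-Z bits carry at most `nz * pz`.

Secrecy: the deviation of Eve's state from its average over the keys involves only characters of the
INFO bits in `Span {v_1, ..., v_{r+m}}` but not in `Span {v_1, ..., v_r}`, which have weight at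
least `K.dist`. Expand Eve's state vectors, as functions of the INFO bits, in characters: the
components of weight less than `K.dist / 2` then contribute nothing in pairs. Since the two
bases are conjugate, the mass of the other components is the probability that the INFO bits, sent in
the `x` basis, carry at least `K.dist / 2` errors although the TEST-X bits carry at most `nx * px`.
-/

noncomputable section

open scoped Matrix.Norms.L2Operator

namespace BB84InfoZ

/-! ### Vectors, matrices and the trace distance -/

section LinearAlgebra

variable {α β : Type*} [Fintype α]

/-- The squared Euclidean norm of a complex vector; the norm of a plain function type would be the
supremum norm. -/
def normSq (v : α → ℂ) : ℝ := ∑ a, ‖v a‖ ^ 2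

theorem normSq_nonneg (v : α → ℂ) : 0 ≤ normSq v := Finset.sum_nonneg fun _ _ => by positivity

theorem normSq_smul (c : ℂ) (v : α → ℂ) : normSq (c • v) = ‖c‖ ^ 2 * normSq v := by
  simp only [normSq, Pi.smul_apply, norm_smul, mul_pow, Finset.mul_sum]

theorem normSq_eq_zero {v : α → ℂ} : normSq v = 0 ↔ v = 0 := by
  simp [normSq, Finset.sum_eq_zero_iff_of_nonneg, funext_iff]

theorem normSq_prod {ι : Type*} [Fintype ι] [DecidableEq ι] {κ : ι → Type*} [∀ j, Fintype (κ j)]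
    (φ : ∀ j, κ j → ℂ) :
    normSq (fun e : ∀ j, κ j => ∏ j, φ j (e j)) = ∏ j, normSq (φ j) := by
  simp only [normSq, norm_prod, ← Finset.prod_pow, Fintype.prod_sum]

theorem norm_toLp_eq_sqrt_normSq (v : α → ℂ) : ‖WithLp.toLp 2 v‖ = √(normSq v) :=
  EuclideanSpace.norm_eq _

theorem trace_mul_vecMulVec_star (M : Matrix α α ℂ) (v : α → ℂ) :
    (M * Matrix.vecMulVec v (star v)).trace = star v ⬝ᵥ M *ᵥ v := by
  rw [Matrix.mul_vecMulVec, Matrix.trace_vecMulVec, dotProduct_comm]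

variable [DecidableEq α]

theorem norm_star_dotProduct_mulVec_le (M : Matrix α α ℂ) (u v : α → ℂ) :
    ‖star u ⬝ᵥ M *ᵥ v‖ ≤ ‖M‖ * (√(normSq u) * √(normSq v)) := by
  have hinner : star u ⬝ᵥ M *ᵥ v = inner ℂ (WithLp.toLp 2 u) (WithLp.toLp 2 (M *ᵥ v)) := by
    rw [EuclideanSpace.inner_toLp_toLp, dotProduct_comm]
  simp only [hinner, ← norm_toLp_eq_sqrt_normSq]
  calc _ ≤ ‖WithLp.toLp 2 u‖ * ‖WithLp.toLp 2 (M *ᵥ v)‖ := norm_inner_le_norm _ _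
    _ ≤ ‖WithLp.toLp 2 u‖ * (‖M‖ * ‖WithLp.toLp 2 v‖) := by
        gcongr
        exact Matrix.l2_opNorm_mulVec M (WithLp.toLp 2 v)
    _ = _ := mul_left_comm _ _ _

theorem norm_one_le : ‖(1 : Matrix α α ℂ)‖ ≤ 1 := by
  rw [← Matrix.diagonal_one, Matrix.l2_opNorm_diagonal]
  exact (pi_norm_le_iff_of_nonneg zero_le_one).2 fun _ => by simp

theorem norm_submatrix_le [Fintype β] [DecidableEq β] {f : α → β} (hf : Function.Injective f)
    (S : Matrix β β ℂ) : ‖S.submatrix f f‖ ≤ ‖S‖ := by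
  set J : Matrix α β ℂ := (1 : Matrix β β ℂ).submatrix f id
  have hJ : ‖J‖ ≤ 1 := by
    have hJJ : J * Jᴴ = 1 := by
      rw [Matrix.conjTranspose_submatrix, Matrix.conjTranspose_one,
        ← Matrix.submatrix_mul _ _ _ _ _ Function.bijective_id, one_mul, Matrix.submatrix_one f hf]
    have h := Matrix.l2_opNorm_conjTranspose_mul_self Jᴴ
    rw [Matrix.conjTranspose_conjTranspose, hJJ, Matrix.l2_opNorm_conjTranspose] at h
    nlinarith [norm_nonneg J, norm_one_le (α := α)]
  have hS : S.submatrix f f = J * S * Jᴴ := by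
    rw [Matrix.conjTranspose_submatrix, Matrix.conjTranspose_one]
    nth_rw 2 [← Matrix.submatrix_id_id S]
    rw [← Matrix.submatrix_mul _ _ _ _ _ Function.bijective_id, one_mul,
      ← Matrix.submatrix_mul _ _ _ _ _ Function.bijective_id, mul_one]
  calc ‖S.submatrix f f‖ ≤ ‖J‖ * ‖S‖ * ‖Jᴴ‖ := by
        rw [hS]
        exact (Matrix.l2_opNorm_mul _ _).trans (by gcongr; exact Matrix.l2_opNorm_mul _ _)
    _ ≤ 1 * ‖S‖ * 1 := by
        rw [Matrix.l2_opNorm_conjTranspose]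
        gcongr
    _ = ‖S‖ := by ring

theorem exists_abs_eq_mul {A : Matrix α α ℂ} (hA : A.IsHermitian) :
    ∃ S : Matrix α α ℂ, ‖S‖ ≤ 1 ∧ CFC.abs A = S * A := by
  have hsa : IsSelfAdjoint A := hA
  have hc (f : ℝ → ℝ) : ContinuousOn f (spectrum ℝ A) := (Set.toFinite _).continuousOn f
  refine ⟨cfc Real.sign A, norm_cfc_le zero_le_one fun x _ => ?_, ?_⟩
  · obtain h | h | h := lt_trichotomy x 0 <;> simp [Real.sign, h, h.not_gt]
  · have habs : (fun x : ℝ => ‖x‖) = fun x => Real.sign x * x := by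
      funext x
      obtain h | h | h := lt_trichotomy x 0
      · rw [Real.norm_of_nonpos h.le, Real.sign_of_neg h, neg_one_mul]
      · simp [h]
      · rw [Real.norm_of_nonneg h.le, Real.sign_of_pos h, one_mul]
    rw [CFC.abs_eq_cfc_norm A hsa, habs, cfc_mul Real.sign (fun x => x) A (hc _) (hc _),
      cfc_id' ℝ A hsa]

/-- Half of the variational characterization of the trace distance: `tr |A| = tr (S A)` for the
sign `S` of `A`, which is a contraction. -/
theorem traceDist_le_of_norm_trace_mul_le {M M' : Matrix α α ℂ} (hM : M.IsHermitian)
    (hM' : M'.IsHermitian) {c : ℝ}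
    (h : ∀ S : Matrix α α ℂ, ‖S‖ ≤ 1 → ‖(S * (M - M')).trace‖ ≤ c) : traceDist M M' ≤ c / 2 := by
  obtain ⟨S, hS, habs⟩ := exists_abs_eq_mul (hM.sub hM')
  rw [traceDist, habs]
  linarith [(Complex.re_le_norm _).trans (h S hS)]

end LinearAlgebra

theorem isHermitian_proj {α : Type*} [DecidableEq α] (a : α) : (proj a).IsHermitian := by
  simp [proj, Matrix.IsHermitian]

/-! ### Fourier analysis of bit strings -/

/-- The sign `(-1) ^ t` of a bit, i.e. the nontrivial additive character of `F_2`. -/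
def sgn : AddChar (ZMod 2) ℂ := AddChar.zmodChar 2 (neg_one_sq (R := ℂ))

theorem bit_cases (t : ZMod 2) : t = 0 ∨ t = 1 := by decide +revert

@[simp] theorem sgn_one : sgn 1 = -1 := by
  rw [sgn, AddChar.zmodChar_apply, ZMod.val_one, pow_one]

theorem star_sgn (t : ZMod 2) : star (sgn t) = sgn t := by
  obtain rfl | rfl := bit_cases t <;> simp

theorem sgn_sum {ι : Type*} (s : Finset ι) (f : ι → ZMod 2) :
    sgn (∑ j ∈ s, f j) = ∏ j ∈ s, sgn (f j) := by
  classical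
  induction s using Finset.induction_on with
  | empty => simp
  | insert j s hj ih =>
    rw [Finset.sum_insert hj, Finset.prod_insert hj, AddChar.map_add_eq_mul, ih]

theorem sum_eq_zero_of_apply_add_eq_neg {G V : Type*} [AddGroup G] [Fintype G] [AddCommGroup V]
    [Module ℂ V] {f : G → V} (y : G) (h : ∀ x, f (x + y) = -f x) : ∑ x, f x = 0 := by
  have hneg : ∑ x, f x = -∑ x, f x := by
    rw [← Finset.sum_neg_distrib, ← Equiv.sum_comp (Equiv.addRight y)]
    exact Finset.sum_congr rfl fun x _ => h x
  refine (smul_eq_zero_iff_right (two_ne_zero (α := ℂ))).1 ?_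
  rw [two_smul]
  nth_rw 1 [hneg]
  exact neg_add_cancel _

section Fourier

variable {ι : Type*} [Fintype ι] [DecidableEq ι]

theorem sum_sgn_dotProduct (u : ι → ZMod 2) :
    ∑ x : ι → ZMod 2, sgn (u ⬝ᵥ x) = if u = 0 then 2 ^ Fintype.card ι else 0 := by
  split_ifs with hu
  · simp [hu, ZMod.card]
  · obtain ⟨j, hj⟩ := Function.ne_iff.1 hu
    refine sum_eq_zero_of_apply_add_eq_neg (Pi.single j 1) fun x => ?_
    rw [dotProduct_add, dotProduct_single, mul_one, (bit_cases _).resolve_left hj,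
      AddChar.map_add_eq_mul, sgn_one, mul_neg_one]

theorem sum_sgn_dotProduct_mul_sgn_dotProduct (a b : ι → ZMod 2) :
    ∑ x : ι → ZMod 2, sgn (a ⬝ᵥ x) * sgn (b ⬝ᵥ x) = if a = b then 2 ^ Fintype.card ι else 0 := by
  simp_rw [← AddChar.map_add_eq_mul, ← add_dotProduct, sum_sgn_dotProduct]
  simp only [← sub_eq_zero (a := a), ZModModule.sub_eq_add]

variable {E : Type*}

theorem sum_normSq_sum_sgn_smul [Fintype E] (s : Finset (ι → ZMod 2)) (g : (ι → ZMod 2) → E → ℂ) :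
    ∑ x : ι → ZMod 2, normSq (∑ a ∈ s, sgn (a ⬝ᵥ x) • g a) =
      2 ^ Fintype.card ι * ∑ a ∈ s, normSq (g a) := by
  have hcoord (e : E) : ∑ x : ι → ZMod 2, ‖∑ a ∈ s, sgn (a ⬝ᵥ x) * g a e‖ ^ 2 =
      2 ^ Fintype.card ι * ∑ a ∈ s, ‖g a e‖ ^ 2 := by
    have hsq (z : ℂ) : ((‖z‖ ^ 2 : ℝ) : ℂ) = z * star z := by
      rw [Complex.star_def, Complex.mul_conj']; norm_cast
    have hmul (a b x : ι → ZMod 2) : sgn (a ⬝ᵥ x) * g a e * (sgn (b ⬝ᵥ x) * star (g b e)) =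
        sgn (a ⬝ᵥ x) * sgn (b ⬝ᵥ x) * (g a e * star (g b e)) := mul_mul_mul_comm ..
    apply Complex.ofReal_injective
    simp only [Complex.ofReal_sum, Complex.ofReal_mul, hsq, star_sum, star_mul', star_sgn,
      Finset.sum_mul_sum, hmul]
    rw [Finset.sum_comm, Finset.mul_sum]
    refine Finset.sum_congr rfl fun a ha => ?_
    rw [Finset.sum_comm]
    simp only [← Finset.sum_mul, sum_sgn_dotProduct_mul_sgn_dotProduct, ite_mul, zero_mul,
      Finset.sum_ite_eq, ha, if_true]
    norm_cast
  simp only [normSq, Finset.sum_apply, Pi.smul_apply, smul_eq_mul]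
  rw [Finset.sum_comm, Finset.sum_comm (s := s), Finset.mul_sum]
  exact Finset.sum_congr rfl fun e _ => hcoord e

/-- The Fourier transform of a vector-valued function of a bit string, normalized so that the
function is the sum of its Fourier components. -/
def fourier (h : (ι → ZMod 2) → E → ℂ) (a : ι → ZMod 2) : E → ℂ :=
  (2 ^ Fintype.card ι : ℂ)⁻¹ • ∑ y, sgn (a ⬝ᵥ y) • h y

theorem sum_sgn_smul_fourier (h : (ι → ZMod 2) → E → ℂ) (x : ι → ZMod 2) :
    ∑ a, sgn (a ⬝ᵥ x) • fourier h a = h x := by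
  simp only [fourier, smul_comm (sgn _) (_ : ℂ)⁻¹, ← Finset.smul_sum]
  rw [inv_smul_eq_iff₀ (pow_ne_zero _ two_ne_zero)]
  simp only [Finset.smul_sum, smul_smul]
  rw [Finset.sum_comm]
  have horth (y : ι → ZMod 2) : ∑ a : ι → ZMod 2, sgn (a ⬝ᵥ x) * sgn (a ⬝ᵥ y) =
      if x = y then 2 ^ Fintype.card ι else 0 := by
    simp only [dotProduct_comm _ x, dotProduct_comm _ y, sum_sgn_dotProduct_mul_sgn_dotProduct]
  simp only [← Finset.sum_smul, horth, ite_smul, zero_smul, Finset.sum_ite_eq, Finset.mem_univ,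
    if_true]

end Fourier

/-! ### Linear codes -/

theorem exists_forall_dotProduct_eq {F κ ι : Type*} [Field F] [Finite κ] [Fintype ι]
    {v : κ → ι → F} (hv : LinearIndependent F v) (c : κ → F) :
    ∃ y : ι → F, ∀ k, v k ⬝ᵥ y = c k := by
  have := Fintype.ofFinite κ
  have hrange : (Matrix.of v).mulVecLin.range = ⊤ := by
    apply Submodule.eq_top_of_finrank_eq
    rw [Module.finrank_fintype_fun_eq_card]
    exact hv.rank_matrix (M := Matrix.of v)
  obtain ⟨y, hy⟩ := LinearMap.range_eq_top.1 hrange c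
  exact ⟨y, congrFun hy⟩

theorem hammingNorm_add_le {ι : Type*} [Fintype ι] {β : ι → Type*} [∀ j, DecidableEq (β j)]
    [∀ j, AddCommGroup (β j)] (a b : ∀ j, β j) :
    hammingNorm (a + b) ≤ hammingNorm a + hammingNorm b := by
  have hneg : hammingNorm (-a) = hammingNorm a := by simp [hammingNorm]
  have h := hammingDist_triangle (-a) 0 b
  rwa [hammingDist_zero_right, hammingDist_zero_left, hammingDist_eq_hammingNorm, neg_neg,
    hneg] at h

namespace Code

variable {n : ℕ} (K : Code n)

theorem syndrome_apply (x : Bits n) (a : Fin K.r) :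
    K.syndrome x a = K.rows (Fin.castAdd K.m a) ⬝ᵥ x := by
  rw [syndrome, rows, Fin.append_left, Matrix.vecMul_transpose]
  rfl

theorem key_apply (x : Bits n) (a : Fin K.m) :
    K.key x a = K.rows (Fin.natAdd K.r a) ⬝ᵥ x := by
  rw [key, rows, Fin.append_right, Matrix.vecMul_transpose]
  rfl

theorem syndrome_add (x y : Bits n) : K.syndrome (x + y) = K.syndrome x + K.syndrome y :=
  Matrix.add_vecMul _ _ _

theorem key_add (x y : Bits n) : K.key (x + y) = K.key x + K.key y := Matrix.add_vecMul _ _ _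

variable {K}

theorem dist_le_hammingDist {l : Fin (K.r + K.m)} (hl : K.r ≤ l) {w : Bits n}
    (hw : w ∈ K.rowSpan l) : K.dist ≤ hammingDist (K.rows l) w :=
  Nat.sInf_le ⟨l, hl, w, hw, rfl⟩

theorem m_pos_of_dist_pos (h : 0 < K.dist) : 0 < K.m := by
  obtain ⟨_, l, hl, -⟩ := Nat.nonempty_of_pos_sInf h
  omega

theorem mem_rowSpan_of_mem_rowSpan_succ {u : Bits n} (hu : hammingNorm u < K.dist)
    {l : Fin (K.r + K.m)} (hl : K.r ≤ l) (h : u ∈ K.rowSpan (l + 1)) : u ∈ K.rowSpan l := by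
  have hset : {a : Fin (K.r + K.m) | (a : ℕ) < l + 1} =
      insert l {a : Fin (K.r + K.m) | (a : ℕ) < l} := by
    ext a
    simp only [Set.mem_ofPred_eq, Set.mem_insert_iff, Fin.ext_iff]
    omega
  rw [rowSpan, hset, Set.image_insert_eq, Submodule.mem_span_insert] at h
  obtain ⟨c, w, hw, rfl⟩ := h
  obtain rfl | rfl := bit_cases c
  · rwa [zero_smul, zero_add]
  · have hdist := dist_le_hammingDist hl hw
    rw [hammingDist_eq_hammingNorm, ZModModule.neg_eq_self] at hdist
    rw [one_smul] at hu
    exact absurd hu hdist.not_gt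

theorem mem_rowSpan_r_of_hammingNorm_lt {u : Bits n} (hu : hammingNorm u < K.dist)
    (h : u ∈ Submodule.span (ZMod 2) (Set.range K.rows)) : u ∈ K.rowSpan K.r := by
  have htop : u ∈ K.rowSpan (K.r + K.m) := by
    have hset : {a : Fin (K.r + K.m) | (a : ℕ) < K.r + K.m} = Set.univ :=
      Set.eq_univ_of_forall Fin.is_lt
    rwa [rowSpan, hset, Set.image_univ]
  refine Nat.decreasingInduction' (P := fun l => u ∈ K.rowSpan l) (fun l hlt hle hl => ?_)
    (Nat.le_add_right _ _) htop
  exact mem_rowSpan_of_mem_rowSpan_succ hu (l := ⟨l, hlt⟩) hle hl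

theorem dotProduct_eq_zero_of_mem_rowSpan {u y : Bits n} (hu : u ∈ K.rowSpan K.r)
    (hy : K.syndrome y = 0) : u ⬝ᵥ y = 0 := by
  induction hu using Submodule.span_induction with
  | mem x h =>
    obtain ⟨a, ha, rfl⟩ := h
    exact (K.syndrome_apply y ⟨a, ha⟩).symm.trans (congrFun hy _)
  | zero => exact zero_dotProduct y
  | add x z _ _ hx hz => rw [add_dotProduct, hx, hz, add_zero]
  | smul c x _ hx => rw [smul_dotProduct, hx, smul_zero]

theorem exists_syndrome_eq_zero_key_eq (hK : LinearIndependent (ZMod 2) K.rows)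
    (κ : Bits K.m) : ∃ y : Bits n, K.syndrome y = 0 ∧ K.key y = κ := by
  obtain ⟨y, hy⟩ := exists_forall_dotProduct_eq hK (Fin.append 0 κ)
  refine ⟨y, funext fun a => ?_, funext fun a => ?_⟩
  · rw [syndrome_apply, hy, Fin.append_left]
  · rw [key_apply, hy, Fin.append_right]

theorem exists_syndrome_key_eq_zero_dotProduct_eq_one (hK : LinearIndependent (ZMod 2) K.rows)
    {u : Bits n} (hu : u ∉ Submodule.span (ZMod 2) (Set.range K.rows)) :
    ∃ y : Bits n, K.syndrome y = 0 ∧ K.key y = 0 ∧ u ⬝ᵥ y = 1 := by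
  obtain ⟨y, hy⟩ := exists_forall_dotProduct_eq (linearIndependent_finCons.2 ⟨hK, hu⟩)
    (Fin.cons 1 0)
  refine ⟨y, funext fun a => ?_, funext fun a => ?_, by simpa using hy 0⟩
  · simpa [syndrome_apply] using hy (Fin.castAdd K.m a).succ
  · simpa [key_apply] using hy (Fin.natAdd K.r a).succ

/-! ### Privacy amplification -/

variable (K) in
/-- The deviation of an observable depending on the key and the syndrome of `x` from its average
over all keys. -/
def keyDefect {V : Type*} [AddCommGroup V] [Module ℂ V] (B : Bits K.m → Bits K.r → V)
    (x : Bits n) : V :=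
  B (K.key x) (K.syndrome x) - (2 ^ K.m : ℂ)⁻¹ • ∑ κ, B κ (K.syndrome x)

theorem norm_keyDefect_le {V : Type*} [NormedAddCommGroup V] [NormedSpace ℂ V]
    {B : Bits K.m → Bits K.r → V} (hB : ∀ κ ξ, ‖B κ ξ‖ ≤ 1) (x : Bits n) :
    ‖K.keyDefect B x‖ ≤ 2 := by
  have havg : ‖(2 ^ K.m : ℂ)⁻¹ • ∑ κ, B κ (K.syndrome x)‖ ≤ 1 := by
    have hsum := norm_sum_le_of_le Finset.univ fun κ _ => hB κ (K.syndrome x)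
    rw [norm_smul, norm_inv, norm_pow, Complex.norm_two, inv_mul_le_one₀ (by positivity)]
    simpa [ZMod.card] using hsum
  exact (norm_sub_le _ _).trans (by linarith [hB (K.key x) (K.syndrome x)])

section Characters

variable {V : Type*} [AddCommGroup V] [Module ℂ V] (B : Bits K.m → Bits K.r → V) {u : Bits n}

theorem sum_sgn_smul_keyDefect_of_mem_rowSpan (hK : LinearIndependent (ZMod 2) K.rows)
    (hu : u ∈ K.rowSpan K.r) : ∑ x : Bits n, sgn (u ⬝ᵥ x) • K.keyDefect B x = 0 := by
  have hshift (κ : Bits K.m) : ∑ x : Bits n, sgn (u ⬝ᵥ x) • B (K.key x + κ) (K.syndrome x) =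
      ∑ x : Bits n, sgn (u ⬝ᵥ x) • B (K.key x) (K.syndrome x) := by
    obtain ⟨y, hy, rfl⟩ := exists_syndrome_eq_zero_key_eq hK κ
    rw [← Equiv.sum_comp (Equiv.addRight y) fun x => sgn (u ⬝ᵥ x) • B (K.key x) (K.syndrome x)]
    refine Finset.sum_congr rfl fun x _ => ?_
    rw [Equiv.coe_addRight, syndrome_add, key_add, hy, add_zero, dotProduct_add,
      dotProduct_eq_zero_of_mem_rowSpan hu hy, add_zero]
  have havg : ∑ x : Bits n, sgn (u ⬝ᵥ x) • ∑ κ, B κ (K.syndrome x) =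
      (2 ^ K.m : ℂ) • ∑ x : Bits n, sgn (u ⬝ᵥ x) • B (K.key x) (K.syndrome x) := by
    calc _ = ∑ x : Bits n, ∑ κ, sgn (u ⬝ᵥ x) • B (K.key x + κ) (K.syndrome x) := by
          refine Finset.sum_congr rfl fun x _ => ?_
          rw [← Equiv.sum_comp (Equiv.addLeft (K.key x)), Finset.smul_sum]
          rfl
      _ = ∑ _κ : Bits K.m, ∑ x : Bits n, sgn (u ⬝ᵥ x) • B (K.key x) (K.syndrome x) := by
          rw [Finset.sum_comm]
          exact Finset.sum_congr rfl fun κ _ => hshift κ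
      _ = _ := by
          rw [Finset.sum_const, Finset.card_univ, ← Nat.cast_smul_eq_nsmul ℂ]
          simp [ZMod.card]
  simp only [keyDefect, smul_sub, Finset.sum_sub_distrib, smul_comm (sgn _) (_ : ℂ)⁻¹]
  rw [← Finset.smul_sum, havg, inv_smul_smul₀ (pow_ne_zero _ two_ne_zero), sub_self]

theorem sum_sgn_smul_keyDefect_of_notMem_span (hK : LinearIndependent (ZMod 2) K.rows)
    (hu : u ∉ Submodule.span (ZMod 2) (Set.range K.rows)) :
    ∑ x : Bits n, sgn (u ⬝ᵥ x) • K.keyDefect B x = 0 := by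
  obtain ⟨y, hsyn, hkey, huy⟩ := exists_syndrome_key_eq_zero_dotProduct_eq_one hK hu
  refine sum_eq_zero_of_apply_add_eq_neg y fun x => ?_
  rw [keyDefect, keyDefect, syndrome_add, key_add, hsyn, hkey, add_zero, add_zero, dotProduct_add,
    huy, AddChar.map_add_eq_mul, sgn_one, mul_neg_one, neg_smul]

theorem sum_sgn_smul_keyDefect_of_hammingNorm_lt (hK : LinearIndependent (ZMod 2) K.rows)
    (hu : hammingNorm u < K.dist) : ∑ x : Bits n, sgn (u ⬝ᵥ x) • K.keyDefect B x = 0 := by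
  by_cases hmem : u ∈ Submodule.span (ZMod 2) (Set.range K.rows)
  · exact sum_sgn_smul_keyDefect_of_mem_rowSpan B hK (mem_rowSpan_r_of_hammingNorm_lt hu hmem)
  · exact sum_sgn_smul_keyDefect_of_notMem_span B hK hmem

end Characters
end Code

section QuadraticForms

variable {E : Type*} [Fintype E] [DecidableEq E]

theorem norm_sum_star_dotProduct_mulVec_le {ι : Type*} [Fintype ι] {T : ι → Matrix E E ℂ} {C : ℝ}
    (hC : 0 ≤ C) (hT : ∀ x, ‖T x‖ ≤ C) (u v : ι → E → ℂ) :
    ‖∑ x, star (u x) ⬝ᵥ T x *ᵥ v x‖ ≤ C * (√(∑ x, normSq (u x)) * √(∑ x, normSq (v x))) := by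
  calc _ ≤ ∑ x, C * (√(normSq (u x)) * √(normSq (v x))) :=
        norm_sum_le_of_le _ fun x _ =>
          (norm_star_dotProduct_mulVec_le _ _ _).trans (by gcongr; exact hT x)
    _ = C * ∑ x, √(normSq (u x)) * √(normSq (v x)) := (Finset.mul_sum ..).symm
    _ ≤ _ := by
        gcongr
        exact Real.sum_sqrt_mul_sqrt_le _ (fun x => normSq_nonneg _) fun x => normSq_nonneg _

namespace Code

variable {n : ℕ} {K : Code n}

omit [DecidableEq E] in
theorem sum_keyDefect_quadratic_form_eq_zero (hK : LinearIndependent (ZMod 2) K.rows)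
    (B : Bits K.m → Bits K.r → Matrix E E ℂ) (g : Bits n → E → ℂ) {s : Finset (Bits n)}
    (hs : ∀ a ∈ s, 2 * hammingNorm a < K.dist) :
    ∑ x : Bits n, star (∑ a ∈ s, sgn (a ⬝ᵥ x) • g a) ⬝ᵥ K.keyDefect B x *ᵥ
      (∑ a ∈ s, sgn (a ⬝ᵥ x) • g a) = 0 := by
  have hexpand (x : Bits n) : star (∑ a ∈ s, sgn (a ⬝ᵥ x) • g a) ⬝ᵥ K.keyDefect B x *ᵥ
      (∑ a ∈ s, sgn (a ⬝ᵥ x) • g a) =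
      ∑ b ∈ s, ∑ a ∈ s, star (g a) ⬝ᵥ (sgn ((b + a) ⬝ᵥ x) • K.keyDefect B x) *ᵥ g b := by
    simp only [star_sum, sum_dotProduct, Matrix.mulVec_sum, dotProduct_sum, star_smul, star_sgn,
      smul_dotProduct, Matrix.mulVec_smul, Matrix.smul_mulVec, dotProduct_smul, add_dotProduct,
      AddChar.map_add_eq_mul, Finset.smul_sum, smul_smul]
  simp only [hexpand]
  rw [Finset.sum_comm]
  refine Finset.sum_eq_zero fun b hb => ?_
  rw [Finset.sum_comm]
  refine Finset.sum_eq_zero fun a ha => ?_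
  have hba : hammingNorm (b + a) < K.dist := by
    linarith [hammingNorm_add_le b a, hs a ha, hs b hb]
  rw [← dotProduct_sum, ← Matrix.sum_mulVec, sum_sgn_smul_keyDefect_of_hammingNorm_lt B hK hba,
    Matrix.zero_mulVec, dotProduct_zero]

/-- Split `h` into its low part `l` and high part `r` in Fourier space. The form of `l` vanishes
since products of low characters are shorter than the distance, so
`⟨h, T h⟩ = ⟨r, T h⟩ + ⟨l, T r⟩` in the mean. -/
theorem norm_sum_keyDefect_quadratic_form_le (hK : LinearIndependent (ZMod 2) K.rows)
    {B : Bits K.m → Bits K.r → Matrix E E ℂ} (hB : ∀ κ ξ, ‖B κ ξ‖ ≤ 1) (h : Bits n → E → ℂ) :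
    ‖∑ x : Bits n, star (h x) ⬝ᵥ K.keyDefect B x *ᵥ h x‖ ≤
      4 * 2 ^ n * (√(∑ a, normSq (fourier h a)) *
        √(∑ a with K.dist ≤ 2 * hammingNorm a, normSq (fourier h a))) := by
  set T := K.keyDefect B
  set high : Finset (Bits n) := {a | K.dist ≤ 2 * hammingNorm a}
  set low : Finset (Bits n) := {a | ¬ K.dist ≤ 2 * hammingNorm a}
  let part (s : Finset (Bits n)) (x : Bits n) : E → ℂ := ∑ a ∈ s, sgn (a ⬝ᵥ x) • fourier h a
  let weight (s : Finset (Bits n)) : ℝ := ∑ a ∈ s, normSq (fourier h a)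
  have hall (x : Bits n) : part Finset.univ x = h x := sum_sgn_smul_fourier h x
  have hsplit (x : Bits n) : h x = part high x + part low x := by
    rw [← hall]
    exact (Finset.sum_filter_add_sum_filter_not _ _ _).symm
  have hform (x : Bits n) : star (h x) ⬝ᵥ T x *ᵥ h x =
      star (part low x) ⬝ᵥ T x *ᵥ part low x +
        (star (part high x) ⬝ᵥ T x *ᵥ h x + star (part low x) ⬝ᵥ T x *ᵥ part high x) := by
    simp only [hsplit x, star_add, add_dotProduct, Matrix.mulVec_add, dotProduct_add]
    ring
  have hlow : ∑ x, star (part low x) ⬝ᵥ T x *ᵥ part low x = 0 :=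
    sum_keyDefect_quadratic_form_eq_zero hK B _ fun a ha => not_le.1 (Finset.mem_filter.1 ha).2
  have hcross (s t : Finset (Bits n)) : ‖∑ x, star (part s x) ⬝ᵥ T x *ᵥ part t x‖ ≤
      2 * 2 ^ n * (√(weight s) * √(weight t)) := by
    have hparseval (s : Finset (Bits n)) : ∑ x, normSq (part s x) = 2 ^ n * weight s := by
      rw [sum_normSq_sum_sgn_smul, Fintype.card_fin]
    refine (norm_sum_star_dotProduct_mulVec_le zero_le_two (norm_keyDefect_le hB) _ _).trans_eq ?_
    rw [hparseval, hparseval, Real.sqrt_mul (by positivity), Real.sqrt_mul (by positivity),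
      mul_mul_mul_comm, Real.mul_self_sqrt (by positivity), mul_assoc]
  have hmono : weight low ≤ weight Finset.univ :=
    Finset.sum_le_univ_sum_of_nonneg fun a => normSq_nonneg _
  calc ‖∑ x, star (h x) ⬝ᵥ T x *ᵥ h x‖
      = ‖∑ x, star (part high x) ⬝ᵥ T x *ᵥ part Finset.univ x +
          ∑ x, star (part low x) ⬝ᵥ T x *ᵥ part high x‖ := by
        simp only [hform, Finset.sum_add_distrib, hlow, zero_add, hall]
    _ ≤ 2 * 2 ^ n * (√(weight high) * √(weight Finset.univ)) +
          2 * 2 ^ n * (√(weight low) * √(weight high)) :=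
        norm_add_le_of_le (hcross _ _) (hcross _ _)
    _ ≤ 2 * 2 ^ n * (√(weight high) * √(weight Finset.univ)) +
          2 * 2 ^ n * (√(weight Finset.univ) * √(weight high)) := by gcongr
    _ = 4 * 2 ^ n * (√(weight Finset.univ) * √(weight high)) := by ring

/-- The advantage of an observer who holds `E x y` when Alice's string is `x` and Bob's is `y`,
bounded by the weight of the Fourier components, in `x` for a fixed error `y - x`, of at least half
the distance. -/
theorem norm_sum_sum_keyDefect_quadratic_form_le (hK : LinearIndependent (ZMod 2) K.rows)
    {B : Bits K.m → Bits K.r → Matrix E E ℂ} (hB : ∀ κ ξ, ‖B κ ξ‖ ≤ 1)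
    (φ : Bits n → Bits n → E → ℂ) :
    ‖∑ x, ∑ y, star (φ x y) ⬝ᵥ K.keyDefect B x *ᵥ φ x y‖ ≤
      4 * 2 ^ n * (√(∑ c, ∑ a, normSq (fourier (fun x => φ x (x + c)) a)) *
        √(∑ c, ∑ a with K.dist ≤ 2 * hammingNorm a,
          normSq (fourier (fun x => φ x (x + c)) a))) := by
  have hreindex : ∑ x, ∑ y, star (φ x y) ⬝ᵥ K.keyDefect B x *ᵥ φ x y =
      ∑ c, ∑ x, star (φ x (x + c)) ⬝ᵥ K.keyDefect B x *ᵥ φ x (x + c) := by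
    rw [Finset.sum_comm (f := fun c x => star (φ x (x + c)) ⬝ᵥ K.keyDefect B x *ᵥ φ x (x + c))]
    exact Finset.sum_congr rfl fun x _ => (Equiv.sum_comp (Equiv.addLeft x) _).symm
  rw [hreindex]
  refine (norm_sum_le_of_le _ fun c _ => norm_sum_keyDefect_quadratic_form_le hK hB _).trans ?_
  rw [← Finset.mul_sum]
  gcongr
  exact Real.sum_sqrt_mul_sqrt_le _ (fun c => Finset.sum_nonneg fun a _ => normSq_nonneg _)
    fun c => Finset.sum_nonneg fun a _ => normSq_nonneg _

end Code

end QuadraticForms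

/-! ### Sampling without replacement -/

section Sampling

open MeasureTheory ProbabilityTheory in
/-- Hoeffding's lemma for a Bernoulli variable. -/
theorem one_add_mul_exp_sub_one_le {p : ℝ} (hp : p ∈ Set.Icc (0 : ℝ) 1) (t : ℝ) :
    1 + p * (Real.exp t - 1) ≤ Real.exp (t * p + t ^ 2 / 8) := by
  let μ : Measure ℝ := bernoulliMeasure 1 0 ⟨p, hp⟩
  have hintegral (f : ℝ → ℝ) : ∫ x, f x ∂μ = p * f 1 + (1 - p) * f 0 :=
    integral_bernoulliMeasure 1 0 ⟨p, hp⟩ f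
  have hmem : ∀ᵐ x ∂μ, id x ∈ Set.Icc (0 : ℝ) 1 := by
    simp [μ, bernoulliMeasure_def, ae_add_measure_iff, Measure.ae_smul_measure, ae_dirac_eq]
  have hmgf := (hasSubgaussianMGF_of_mem_Icc aemeasurable_id hmem).mgf_le t
  have hmean : mgf (fun x => id x - μ[id]) μ t =
      Real.exp (-(t * p)) * (1 + p * (Real.exp t - 1)) := by
    rw [mgf, hintegral, hintegral]
    simp [mul_sub, Real.exp_sub, Real.exp_neg]
    ring
  rw [hmean, Real.exp_neg, inv_mul_le_iff₀ (Real.exp_pos _), ← Real.exp_add] at hmgf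
  exact hmgf.trans_eq (by norm_num; ring_nf)

theorem pow_mul_descFactorial_le {w M : ℕ} (h : w ≤ M) (k : ℕ) :
    M ^ k * w.descFactorial k ≤ w ^ k * M.descFactorial k := by
  induction k with
  | zero => simp
  | succ k ih =>
    have hfactor : M * (w - k) ≤ w * (M - k) := by
      rw [Nat.mul_sub, Nat.mul_sub, Nat.mul_comm M w]
      gcongr
    calc M ^ (k + 1) * w.descFactorial (k + 1)
        = (M * (w - k)) * (M ^ k * w.descFactorial k) := by
          rw [Nat.descFactorial_succ, pow_succ]; ring
      _ ≤ (w * (M - k)) * (w ^ k * M.descFactorial k) := Nat.mul_le_mul hfactor ih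
      _ = w ^ (k + 1) * M.descFactorial (k + 1) := by
          rw [Nat.descFactorial_succ, pow_succ]; ring

theorem choose_le_div_pow_mul_choose {w M : ℕ} (h : w ≤ M) (k : ℕ) :
    (w.choose k : ℝ) ≤ (w / M) ^ k * M.choose k := by
  obtain rfl | hM := M.eq_zero_or_pos
  · cases k <;> simp [Nat.le_zero.mp h]
  · have hdesc := pow_mul_descFactorial_le h k
    rw [Nat.descFactorial_eq_factorial_mul_choose, Nat.descFactorial_eq_factorial_mul_choose,
      mul_left_comm, mul_left_comm (w ^ k)] at hdesc
    have hchoose := Nat.le_of_mul_le_mul_left hdesc k.factorial_pos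
    rw [div_pow, div_mul_eq_mul_div, le_div_iff₀ (by positivity), mul_comm]
    exact_mod_cast hchoose

variable {α : Type*} [DecidableEq α]

theorem sum_powersetCard_choose_card_inter {A W : Finset α} (hW : W ⊆ A) {n k : ℕ} (hk : k ≤ n) :
    ∑ s ∈ A.powersetCard n, (s ∩ W).card.choose k =
      W.card.choose k * (A.card - k).choose (n - k) := by
  calc ∑ s ∈ A.powersetCard n, (s ∩ W).card.choose k
      = ∑ s ∈ A.powersetCard n, ((W.powersetCard k).filter (· ⊆ s)).card := by
        refine Finset.sum_congr rfl fun s _ => ?_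
        rw [← Finset.card_powersetCard]
        congr 1
        ext T
        simp only [Finset.mem_powersetCard, Finset.subset_inter_iff, Finset.mem_filter]
        tauto
    _ = ∑ T ∈ W.powersetCard k, ((A.powersetCard n).filter (T ⊆ ·)).card := by
        simp only [Finset.card_filter]
        exact Finset.sum_comm
    _ = ∑ _T ∈ W.powersetCard k, (A.card - k).choose (n - k) := by
        refine Finset.sum_congr rfl fun _ hT => ?_
        obtain ⟨hTW, rfl⟩ := Finset.mem_powersetCard.mp hT
        exact Finset.card_filter_powersetCard_subset _ _ _ (hTW.trans hW) hk
    _ = W.card.choose k * (A.card - k).choose (n - k) := by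
        rw [Finset.sum_const, Finset.card_powersetCard, smul_eq_mul]

/-- The moment generating function of the hypergeometric distribution is dominated by that of the
binomial distribution. -/
theorem sum_powersetCard_pow_card_inter_le {A W : Finset α} (hW : W ⊆ A) (n : ℕ)
    {y : ℝ} (hy : 0 ≤ y) :
    ∑ s ∈ A.powersetCard n, (1 + y) ^ (s ∩ W).card ≤
      A.card.choose n * (1 + (W.card : ℝ) / A.card * y) ^ n := by
  have hexpand (s : Finset α) (hs : s ∈ A.powersetCard n) :
      (1 + y) ^ (s ∩ W).card = ∑ k ∈ Finset.range (n + 1), y ^ k * (s ∩ W).card.choose k := by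
    have hcard : (s ∩ W).card ≤ n :=
      (Finset.card_le_card Finset.inter_subset_left).trans_eq (Finset.mem_powersetCard.mp hs).2
    rw [add_comm, add_pow]
    simp only [one_pow, mul_one]
    refine Finset.sum_subset (Finset.range_subset_range.mpr (by lia)) fun k _ hk => ?_
    rw [Finset.mem_range, not_lt] at hk
    rw [Nat.choose_eq_zero_of_lt (by lia), Nat.cast_zero, mul_zero]
  rw [Finset.sum_congr rfl hexpand, Finset.sum_comm, add_comm (1 : ℝ), add_pow, Finset.mul_sum]
  refine Finset.sum_le_sum fun k hk => ?_
  have hkn : k ≤ n := by rw [Finset.mem_range] at hk; lia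
  calc ∑ s ∈ A.powersetCard n, y ^ k * ((s ∩ W).card.choose k : ℝ)
      = y ^ k * (W.card.choose k * (A.card - k).choose (n - k)) := by
        rw [← Finset.mul_sum]
        exact_mod_cast congrArg (y ^ k * ·)
          (congrArg (Nat.cast (R := ℝ)) (sum_powersetCard_choose_card_inter hW hkn))
    _ ≤ y ^ k * (((W.card : ℝ) / A.card) ^ k * A.card.choose k *
          (A.card - k).choose (n - k)) := by
        gcongr
        exact choose_le_div_pow_mul_choose (Finset.card_le_card hW) k
    _ = ((W.card : ℝ) / A.card * y) ^ k * (A.card.choose k * (A.card - k).choose (n - k) : ℕ) := by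
        push_cast
        ring
    _ = A.card.choose n * (((W.card : ℝ) / A.card * y) ^ k * 1 ^ (n - k) * n.choose k) := by
        rw [← Nat.choose_mul hkn]
        push_cast
        ring

/-- Chernoff's bound for the hypergeometric distribution. -/
theorem card_filter_le_card_inter_le {A W : Finset α} (hW : W ⊆ A) (n : ℕ) {t : ℝ} (ht : 0 ≤ t) :
    (((A.powersetCard n).filter fun s =>
      n * ((W.card : ℝ) / A.card + t) ≤ ((s ∩ W).card : ℝ)).card : ℝ) ≤
      A.card.choose n * Real.exp (-2 * n * t ^ 2) := by
  set q : ℝ := (W.card : ℝ) / A.card with hq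
  have hq01 : q ∈ Set.Icc (0 : ℝ) 1 :=
    ⟨by positivity, div_le_one_of_le₀ (by exact_mod_cast Finset.card_le_card hW) (by positivity)⟩
  have hy : 0 ≤ Real.exp (4 * t) - 1 := sub_nonneg.mpr (Real.one_le_exp (by positivity))
  have hmarkov : (((A.powersetCard n).filter fun s => n * (q + t) ≤ ((s ∩ W).card : ℝ)).card : ℝ) *
      Real.exp (4 * t * (n * (q + t))) ≤
      ∑ s ∈ A.powersetCard n, (1 + (Real.exp (4 * t) - 1)) ^ (s ∩ W).card := by
    rw [← nsmul_eq_mul, ← Finset.sum_const]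
    refine (Finset.sum_le_sum fun s hs => ?_).trans
      (Finset.sum_le_sum_of_subset_of_nonneg (Finset.filter_subset _ _) fun s _ _ => by positivity)
    rw [add_sub_cancel, ← Real.exp_nat_mul, Real.exp_le_exp, mul_comm]
    exact mul_le_mul_of_nonneg_right (Finset.mem_filter.mp hs).2 (by positivity)
  have hmgf : (1 + q * (Real.exp (4 * t) - 1)) ^ n ≤
      Real.exp (n * (4 * t * q + (4 * t) ^ 2 / 8)) := by
    rw [Real.exp_nat_mul]
    exact pow_le_pow_left₀ (add_nonneg zero_le_one (mul_nonneg hq01.1 hy))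
      (one_add_mul_exp_sub_one_le hq01 _) n
  have hbound := (hmarkov.trans (sum_powersetCard_pow_card_inter_le hW n hy)).trans
    (mul_le_mul_of_nonneg_left hmgf (by positivity))
  rw [← le_div_iff₀ (Real.exp_pos _), mul_div_assoc, ← Real.exp_sub] at hbound
  exact hbound.trans_eq (by ring_nf)

/-- It is unlikely that the error rate of a sample `s` exceeds that of the remaining positions
by `ε`. -/
theorem card_filter_error_rates_le {A W : Finset α} (hW : W ⊆ A) {n l : ℕ}
    (hA : A.card = n + l) {p ε : ℝ} (hε : 0 ≤ ε) :
    (((A.powersetCard n).filter fun s =>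
      n * (p + ε) ≤ ((W ∩ s).card : ℝ) ∧ ((W \ s).card : ℝ) ≤ l * p).card : ℝ) ≤
      (n + l).choose n * Real.exp (-2 * ((l : ℝ) / (n + l)) ^ 2 * n * ε ^ 2) := by
  set t : ℝ := l / (n + l) * ε with ht
  calc _ ≤ (((A.powersetCard n).filter fun s =>
        n * ((W.card : ℝ) / A.card + t) ≤ ((s ∩ W).card : ℝ)).card : ℝ) := by
        gcongr with s
        rintro ⟨hsample, hrest⟩
        have hcard : (W.card : ℝ) = (W \ s).card + (W ∩ s).card := by
          exact_mod_cast (Finset.card_sdiff_add_card_inter W s).symm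
        rw [Finset.inter_comm s, hA, hcard, ht, div_mul_eq_mul_div, Nat.cast_add, ← add_div,
          mul_div_assoc']
        refine div_le_of_le_mul₀ (by positivity) (by positivity) ?_
        have hn : (n : ℝ) * (W \ s).card ≤ n * (l * p) := by gcongr
        have hl : (l : ℝ) * (n * (p + ε)) ≤ l * (W ∩ s).card := by gcongr
        linarith
    _ ≤ (n + l).choose n * Real.exp (-2 * n * t ^ 2) := by
        rw [← hA]
        exact card_filter_le_card_inter_le hW n (by positivity)
    _ = _ := by
        rw [ht]
        ring_nf

end Sampling

/-! ### Collective attacks -/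

theorem sum_normSq_sum_sgn_mul_smul {E : Type*} [Fintype E] (v : ZMod 2 → E → ℂ) :
    ∑ i, normSq (∑ t, sgn (i * t) • v t) = 2 * ∑ t, normSq (v t) := by
  have hsum {M : Type} [AddCommMonoid M] (f : ZMod 2 → M) : ∑ t, f t = f 0 + f 1 :=
    Fin.sum_univ_two f
  have hpar (z w : ℂ) : ‖z + w‖ ^ 2 + ‖z - w‖ ^ 2 = 2 * (‖z‖ ^ 2 + ‖w‖ ^ 2) := by
    simpa only [sq] using parallelogram_law_with_norm ℝ z w
  simp only [normSq, Finset.sum_apply, Pi.smul_apply]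
  rw [Finset.sum_comm]
  conv_rhs => rw [Finset.sum_comm, Finset.mul_sum]
  refine Finset.sum_congr rfl fun e _ => ?_
  simp only [hsum, mul_zero, mul_one, AddChar.map_zero_eq_one, sgn_one, one_smul,
    neg_one_smul, ← sub_eq_add_neg, hpar]

theorem ket_zero (i t : ZMod 2) : ket 0 i t = if t = i then 1 else 0 := if_pos rfl

theorem ket_one (i t : ZMod 2) : ket 1 i t = (√2 : ℂ)⁻¹ * sgn (i * t) := by
  obtain rfl | rfl := bit_cases i <;> obtain rfl | rfl := bit_cases t <;>
    simp [ket, neg_div]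

theorem normSq_ket (b i : ZMod 2) : normSq (ket b i) = 1 := by
  obtain rfl | rfl := bit_cases b
  · simp [normSq, ket_zero, apply_ite]
  · simp [normSq, ket_one]

namespace CollectiveAttack

variable {N : ℕ} (𝒜 : CollectiveAttack N) (j : Fin N)

theorem normSq_afterAttack (b i : ZMod 2) : normSq (𝒜.afterAttack j b i) = 1 := by
  have hmulVec (v : Fin (𝒜.dim j) × ZMod 2 → ℂ) :
      normSq ((𝒜.U j : Matrix (Fin (𝒜.dim j) × ZMod 2) (Fin (𝒜.dim j) × ZMod 2) ℂ) *ᵥ v) =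
        normSq v := by
    have hself {α : Type} [Fintype α] (w : α → ℂ) : (normSq w : ℂ) = star w ⬝ᵥ w := by
      simp [normSq, dotProduct, Complex.conj_mul']
    apply Complex.ofReal_injective
    rw [hself, hself, Matrix.star_mulVec, Matrix.dotProduct_mulVec, Matrix.vecMul_vecMul,
      ← Matrix.star_eq_conjTranspose, Matrix.UnitaryGroup.star_mul_self, Matrix.vecMul_one]
  rw [afterAttack, hmulVec, normSq, Fintype.sum_prod_type]
  simp only [norm_mul, mul_pow, ← Finset.mul_sum]
  change ∑ e, ‖𝒜.init j e‖ ^ 2 * normSq (ket b i) = 1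
  simp only [normSq_ket, mul_one, 𝒜.init_unit]

theorem afterAttack_one (i : ZMod 2) :
    𝒜.afterAttack j 1 i = ∑ x, ket 1 i x • 𝒜.afterAttack j 0 x := by
  simp only [afterAttack, ← Matrix.mulVec_smul, ← Matrix.mulVec_sum]
  congr 1
  funext et
  simp [Finset.sum_apply, ket_zero, mul_comm]

theorem probeVec_zero (i i' : ZMod 2) :
    𝒜.probeVec j 0 i i' = fun e => 𝒜.afterAttack j 0 i (e, i') := by
  funext e
  simp [probeVec, ket_zero, apply_ite]

theorem probeVec_one (i i' : ZMod 2) :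
    𝒜.probeVec j 1 i i' =
      (√2 : ℂ)⁻¹ • ∑ t, sgn (i' * t) • fun e => 𝒜.afterAttack j 1 i (e, t) := by
  funext e
  simp only [probeVec, ket_one, star_mul', star_inv₀, star_sgn, Complex.star_def,
    Complex.conj_ofReal, Pi.smul_apply, Finset.sum_apply, smul_eq_mul, Finset.mul_sum, mul_assoc]

theorem sum_normSq_probeVec (b i : ZMod 2) : ∑ i', normSq (𝒜.probeVec j b i i') = 1 := by
  have hsum : ∑ t, normSq (fun e => 𝒜.afterAttack j b i (e, t)) = 1 := by
    rw [← 𝒜.normSq_afterAttack j b i, normSq, Fintype.sum_prod_type_right]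
    rfl
  obtain rfl | rfl := bit_cases b
  · simpa only [probeVec_zero] using hsum
  · simp only [probeVec_one, normSq_smul, ← Finset.mul_sum, sum_normSq_sum_sgn_mul_smul, hsum]
    norm_num

/-- The probability of the error `a` on the `j`-th qubit when a random bit is sent in the
basis `b`. -/
def errProb (b a : ZMod 2) : ℝ := (1 / 2) * ∑ x, normSq (𝒜.probeVec j b x (x + a))

theorem errProb_nonneg (b a : ZMod 2) : 0 ≤ 𝒜.errProb j b a :=
  mul_nonneg (by norm_num) (Finset.sum_nonneg fun _ _ => normSq_nonneg _)

theorem sum_errProb (b : ZMod 2) : ∑ a, 𝒜.errProb j b a = 1 := by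
  have hsum (x : ZMod 2) : ∑ a, normSq (𝒜.probeVec j b x (x + a)) = 1 := by
    rw [← 𝒜.sum_normSq_probeVec j b x]
    exact Equiv.sum_comp (Equiv.addLeft x) fun y => normSq (𝒜.probeVec j b x y)
  simp only [errProb]
  rw [← Finset.mul_sum, Finset.sum_comm]
  simp [hsum]

theorem probeVec_one_add (i a : ZMod 2) :
    𝒜.probeVec j 1 i (i + a) =
      (1 / 2 : ℂ) • ∑ c, sgn (i * c) • sgn (a * c) •
        ∑ x, sgn (a * x) • 𝒜.probeVec j 0 x (x + c) := by
  have hsqrt : (√2 : ℂ)⁻¹ * (√2 : ℂ)⁻¹ = 1 / 2 := by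
    rw [← mul_inv, ← Complex.ofReal_mul, Real.mul_self_sqrt zero_le_two]
    norm_num
  have hsgn (x c : ZMod 2) : sgn ((i + a) * (x + c)) * sgn (i * x) =
      sgn (i * c) * (sgn (a * c) * sgn (a * x)) := by
    simp only [← AddChar.map_add_eq_mul]
    congr 1
    linear_combination CharTwo.add_self_eq_zero (i * x)
  funext e
  simp only [probeVec_one, afterAttack_one, probeVec_zero, ket_one, Pi.smul_apply,
    Finset.sum_apply, smul_eq_mul, Finset.mul_sum]
  rw [Finset.sum_comm]
  conv_rhs => rw [Finset.sum_comm]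
  refine Finset.sum_congr rfl fun x _ => ?_
  rw [← Equiv.sum_comp (Equiv.addLeft x)]
  refine Finset.sum_congr rfl fun c _ => ?_
  rw [Equiv.coe_addLeft]
  linear_combination (𝒜.afterAttack j 0 x (e, x + c)) *
    ((sgn ((i + a) * (x + c)) * sgn (i * x)) * hsqrt + (1 / 2) * hsgn x c)

/-- The two bases are conjugate: the error probabilities in the `x` basis are the squared norms of
the Fourier components of the amplitudes in the `z` basis. -/
theorem errProb_one_eq_sum_normSq (a : ZMod 2) :
    𝒜.errProb j 1 a =
      ∑ c, normSq ((1 / 2 : ℂ) • ∑ x, sgn (a * x) • 𝒜.probeVec j 0 x (x + c)) := by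
  have hnorm (t : ZMod 2) : ‖sgn t‖ = 1 := by obtain rfl | rfl := bit_cases t <;> simp
  simp only [errProb, probeVec_one_add, normSq_smul, ← Finset.mul_sum, sum_normSq_sum_sgn_mul_smul,
    hnorm]
  norm_num
  ring

theorem outcomeProb_eq_normSq (b i iB : Bits N) :
    𝒜.outcomeProb b i iB = normSq (𝒜.eveVec b i iB) := rfl

theorem normSq_eveVec (b i iB : Bits N) :
    normSq (𝒜.eveVec b i iB) = ∏ j, normSq (𝒜.probeVec j (b j) (i j) (iB j)) :=
  normSq_prod fun j => 𝒜.probeVec j (b j) (i j) (iB j)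

/-- The probability of the error string `e` when a random string is sent in the bases `b`. -/
def errDist (b e : Bits N) : ℝ := ∏ j, 𝒜.errProb j (b j) (e j)

theorem errDist_nonneg (b e : Bits N) : 0 ≤ 𝒜.errDist b e :=
  Finset.prod_nonneg fun _ _ => 𝒜.errProb_nonneg _ _ _

theorem sum_errDist (b : Bits N) : ∑ e, 𝒜.errDist b e = 1 := by
  simp only [errDist]
  rw [← Fintype.prod_sum fun j a => 𝒜.errProb j (b j) a]
  simp only [sum_errProb, Finset.prod_const_one]

theorem sum_prod_normSq_probeVec {ι : Type*} [Fintype ι] [DecidableEq ι] (q : ι → Fin N)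
    (b a : ι → ZMod 2) :
    ∑ t : ι → ZMod 2, ∏ k, normSq (𝒜.probeVec (q k) (b k) (t k) (t k + a k)) =
      2 ^ Fintype.card ι * ∏ k, 𝒜.errProb (q k) (b k) (a k) := by
  rw [← Fintype.prod_sum fun k x => normSq (𝒜.probeVec (q k) (b k) x (x + a k)), Fintype.card,
    ← Finset.prod_const, ← Finset.prod_mul_distrib]
  refine Finset.prod_congr rfl fun k _ => ?_
  rw [errProb]
  ring

theorem sum_outcomeProb_add (b e : Bits N) :
    ∑ i, 𝒜.outcomeProb b i (i + e) = 2 ^ N * 𝒜.errDist b e := by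
  simp only [outcomeProb_eq_normSq, normSq_eveVec]
  exact (𝒜.sum_prod_normSq_probeVec id b e).trans (by rw [Fintype.card_fin, errDist]; rfl)

end CollectiveAttack

/-! ### Partitions of the positions -/

/-- The correspondence between bit strings and their supports, the sets of positions of the
ones. -/
def supp {N : ℕ} : Bits N ≃ Finset (Fin N) where
  toFun s := {j | s j ≠ 0}
  invFun A j := if j ∈ A then 1 else 0
  left_inv s := by
    funext j
    obtain h | h := bit_cases (s j) <;> simp [h]
  right_inv A := by
    ext j
    simp

theorem mem_supp {N : ℕ} {s : Bits N} {j : Fin N} : j ∈ supp s ↔ s j ≠ 0 := by simp [supp]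

theorem card_supp {N : ℕ} (s : Bits N) : (supp s).card = hammingNorm s := rfl

theorem exists_orderEmbOfFin_supp_eq {N k : ℕ} {s : Bits N} (hs : (supp s).card = k) {j : Fin N}
    (hj : j ∈ supp s) : ∃ a, (supp s).orderEmbOfFin hs a = j := by
  rwa [← Set.mem_range, Finset.range_orderEmbOfFin]

theorem hammingNorm_substring {N k : ℕ} (s : Bits N) (hs : hammingNorm s = k) (i : Bits N) :
    hammingNorm (substring s hs i) = (supp i ∩ supp s).card := by
  have hmap : supp i ∩ supp s = (supp (substring s hs i)).map
      ((supp s).orderEmbOfFin hs).toEmbedding := by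
    ext j
    simp only [Finset.mem_inter, Finset.mem_map, RelEmbedding.coe_toEmbedding]
    constructor
    · rintro ⟨hi, hj⟩
      obtain ⟨a, rfl⟩ := exists_orderEmbOfFin_supp_eq hs hj
      exact ⟨a, mem_supp.2 (mem_supp.1 hi :), rfl⟩
    · rintro ⟨a, ha, rfl⟩
      exact ⟨mem_supp.2 (mem_supp.1 ha :), Finset.orderEmbOfFin_mem _ hs a⟩
  rw [hmap, Finset.card_map, card_supp]

theorem disjoint_of_card_add_card_le {α : Type*} [DecidableEq α] {A B C : Finset α}
    (h : A.card + B.card + C.card ≤ (A ∪ B ∪ C).card) : Disjoint A B := by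
  rw [← Finset.card_union_eq_card_add_card]
  have h1 := Finset.card_union_le (A ∪ B) C
  have h2 := Finset.card_union_le A B
  omega

namespace Partition

section

variable {n nz nx : ℕ} (P : Partition n nz nx)

/-- The set of INFO positions. -/
def infoSet : Finset (Fin (n + nz + nx)) := supp P.1.1

/-- The set of TEST-Z positions. -/
def testZSet : Finset (Fin (n + nz + nx)) := supp P.1.2.1

/-- The set of TEST-X positions. -/
def testXSet : Finset (Fin (n + nz + nx)) := supp P.1.2.2

theorem card_infoSet : P.infoSet.card = n := P.2.1

theorem card_testZSet : P.testZSet.card = nz := P.2.2.1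

theorem card_testXSet : P.testXSet.card = nx := P.2.2.2.1

theorem union_eq_univ : P.infoSet ∪ P.testZSet ∪ P.testXSet = Finset.univ := by
  have hsupp : supp (P.1.1 + P.1.2.1 + P.1.2.2) = Finset.univ :=
    Finset.eq_univ_of_card _ (by rw [card_supp, P.2.2.2.2, Fintype.card_fin])
  refine Finset.eq_univ_of_forall fun j => ?_
  have hj := mem_supp.1 (hsupp ▸ Finset.mem_univ j)
  contrapose! hj
  simp_all [infoSet, testZSet, testXSet, mem_supp]

theorem disjoint_infoSet_testZSet : Disjoint P.infoSet P.testZSet :=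
  disjoint_of_card_add_card_le (C := P.testXSet) (by
    rw [union_eq_univ, Finset.card_univ, Fintype.card_fin, card_infoSet, card_testZSet,
      card_testXSet])

theorem disjoint_infoSet_testXSet : Disjoint P.infoSet P.testXSet :=
  disjoint_of_card_add_card_le (C := P.testZSet) (by
    rw [Finset.union_right_comm, union_eq_univ, Finset.card_univ, Fintype.card_fin, card_infoSet,
      card_testZSet, card_testXSet, add_right_comm])

theorem disjoint_testZSet_testXSet : Disjoint P.testZSet P.testXSet :=
  disjoint_of_card_add_card_le (C := P.infoSet) (by
    rw [Finset.union_comm, ← Finset.union_assoc, union_eq_univ, Finset.card_univ,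
      Fintype.card_fin, card_infoSet, card_testZSet, card_testXSet, add_comm, ← add_assoc])

theorem testXSet_eq : P.testXSet = P.testZSetᶜ \ P.infoSet := by
  rw [Finset.sdiff_eq_inter_compl, ← Finset.compl_union, Finset.union_comm]
  exact .symm <| IsCompl.compl_eq ⟨Finset.disjoint_union_left.2
    ⟨P.disjoint_infoSet_testXSet, P.disjoint_testZSet_testXSet⟩,
    codisjoint_iff.2 P.union_eq_univ⟩

theorem testZSet_eq : P.testZSet = P.testXSetᶜ \ P.infoSet := by
  rw [Finset.sdiff_eq_inter_compl, ← Finset.compl_union, Finset.union_comm]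
  exact .symm <| IsCompl.compl_eq ⟨Finset.disjoint_union_left.2
    ⟨P.disjoint_infoSet_testZSet, P.disjoint_testZSet_testXSet.symm⟩,
    codisjoint_iff.2 ((Finset.union_right_comm ..).trans P.union_eq_univ)⟩

theorem exists_of_disjoint {A B C : Finset (Fin (n + nz + nx))} (hA : A.card = n) (hB : B.card = nz)
    (hC : C.card = nx) (hAB : Disjoint A B) (hAC : Disjoint A C) (hBC : Disjoint B C) :
    ∃ P : Partition n nz nx, P.infoSet = A ∧ P.testZSet = B ∧ P.testXSet = C := by
  have hcard {D : Finset (Fin (n + nz + nx))} : hammingNorm (supp.symm D) = D.card := by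
    rw [← card_supp, Equiv.apply_symm_apply]
  have hsupp : supp (supp.symm A + supp.symm B + supp.symm C) = A ∪ B ∪ C := by
    ext j
    have hABj : j ∈ A → j ∉ B := (Finset.disjoint_left.1 hAB ·)
    have hACj : j ∈ A → j ∉ C := (Finset.disjoint_left.1 hAC ·)
    have hBCj : j ∈ B → j ∉ C := (Finset.disjoint_left.1 hBC ·)
    by_cases j ∈ A <;> by_cases j ∈ B <;> by_cases j ∈ C <;>
      simp_all [supp]
  refine ⟨⟨(supp.symm A, supp.symm B, supp.symm C), hcard.trans hA, hcard.trans hB,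
    hcard.trans hC, ?_⟩, supp.apply_symm_apply A, supp.apply_symm_apply B,
    supp.apply_symm_apply C⟩
  rw [← card_supp, hsupp, Finset.card_union_of_disjoint (Finset.disjoint_union_left.2 ⟨hAC, hBC⟩),
    Finset.card_union_of_disjoint hAB, hA, hB, hC]

theorem ext_sets {P Q : Partition n nz nx} (hS : P.infoSet = Q.infoSet)
    (hZ : P.testZSet = Q.testZSet) (hX : P.testXSet = Q.testXSet) : P = Q :=
  Subtype.ext (Prod.ext (supp.injective hS)
    (Prod.ext (supp.injective hZ) (supp.injective hX)))

/-- The enumeration of all the positions: INFO, TEST-Z and TEST-X, in increasing order each. -/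
def position : Fin n ⊕ (Fin nz ⊕ Fin nx) → Fin (n + nz + nx) :=
  Sum.elim (P.infoSet.orderEmbOfFin P.card_infoSet)
    (Sum.elim (P.testZSet.orderEmbOfFin P.card_testZSet)
      (P.testXSet.orderEmbOfFin P.card_testXSet))

theorem position_bijective : Function.Bijective P.position := by
  rw [Fintype.bijective_iff_surjective_and_card]
  refine ⟨fun j => ?_, by simp [add_assoc]⟩
  have hj : j ∈ P.infoSet ∪ P.testZSet ∪ P.testXSet := P.union_eq_univ ▸ Finset.mem_univ j
  rw [Finset.mem_union, Finset.mem_union] at hj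
  obtain (hS | hZ) | hX := hj
  · obtain ⟨a, ha⟩ := exists_orderEmbOfFin_supp_eq P.card_infoSet hS
    exact ⟨.inl a, ha⟩
  · obtain ⟨a, ha⟩ := exists_orderEmbOfFin_supp_eq P.card_testZSet hZ
    exact ⟨.inr (.inl a), ha⟩
  · obtain ⟨a, ha⟩ := exists_orderEmbOfFin_supp_eq P.card_testXSet hX
    exact ⟨.inr (.inr a), ha⟩

/-- `Partition.position` as an equivalence. -/
def positionEquiv : Fin n ⊕ (Fin nz ⊕ Fin nx) ≃ Fin (n + nz + nx) :=
  Equiv.ofBijective P.position P.position_bijective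

/-- The INFO positions in increasing order. -/
def infoPos (a : Fin n) : Fin (n + nz + nx) := P.position (.inl a)

/-- The TEST-Z positions in increasing order. -/
def testZPos (a : Fin nz) : Fin (n + nz + nx) := P.position (.inr (.inl a))

/-- The TEST-X positions in increasing order. -/
def testXPos (a : Fin nx) : Fin (n + nz + nx) := P.position (.inr (.inr a))

theorem bases_eq_zero_iff {j : Fin (n + nz + nx)} : P.bases j = 0 ↔ j ∉ P.testXSet := by
  simp [testXSet, mem_supp, bases]

theorem bases_infoPos (a : Fin n) : P.bases (P.infoPos a) = 0 :=
  P.bases_eq_zero_iff.2 (Finset.disjoint_left.1 P.disjoint_infoSet_testXSet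
    (Finset.orderEmbOfFin_mem _ P.card_infoSet a))

theorem bases_testZPos (a : Fin nz) : P.bases (P.testZPos a) = 0 :=
  P.bases_eq_zero_iff.2 (Finset.disjoint_left.1 P.disjoint_testZSet_testXSet
    (Finset.orderEmbOfFin_mem _ P.card_testZSet a))

theorem bases_testXPos (a : Fin nx) : P.bases (P.testXPos a) = 1 :=
  (bit_cases _).resolve_left fun h => P.bases_eq_zero_iff.1 h
    (Finset.orderEmbOfFin_mem _ P.card_testXSet a)

/-- The bases of the modified protocol, used only in the proof of secrecy, in which the INFO bits
are sent in the `x` basis and the test bits as before. -/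
def conjBases : Bits (n + nz + nx) := P.1.2.1 + 1

theorem conjBases_eq_one_iff {j : Fin (n + nz + nx)} : P.conjBases j = 1 ↔ j ∉ P.testZSet := by
  simp [testZSet, mem_supp, conjBases]

theorem conjBases_infoPos (a : Fin n) : P.conjBases (P.infoPos a) = 1 :=
  P.conjBases_eq_one_iff.2 (Finset.disjoint_left.1 P.disjoint_infoSet_testZSet
    (Finset.orderEmbOfFin_mem _ P.card_infoSet a))

theorem conjBases_testZPos (a : Fin nz) : P.conjBases (P.testZPos a) = 0 :=
  (bit_cases _).resolve_right fun h => P.conjBases_eq_one_iff.1 h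
    (Finset.orderEmbOfFin_mem _ P.card_testZSet a)

theorem conjBases_testXPos (a : Fin nx) : P.conjBases (P.testXPos a) = 1 :=
  P.conjBases_eq_one_iff.2 (Finset.disjoint_right.1 P.disjoint_testZSet_testXSet
    (Finset.orderEmbOfFin_mem _ P.card_testXSet a))

theorem prod_position {M : Type*} [CommMonoid M] (f : Fin (n + nz + nx) → M) :
    ∏ j, f j = (∏ a, f (P.infoPos a)) * ((∏ a, f (P.testZPos a)) * ∏ a, f (P.testXPos a)) := by
  rw [← Equiv.prod_comp P.positionEquiv, Fintype.prod_sum_type, Fintype.prod_sum_type]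
  rfl

/-- The decomposition of strings into the INFO, TEST-Z and TEST-X substrings. -/
def bitsEquiv : Bits (n + nz + nx) ≃ Bits n × Bits nz × Bits nx :=
  (P.positionEquiv.symm.arrowCongr (Equiv.refl _)).trans
    ((Equiv.sumArrowEquivProdArrow _ _ _).trans
      ((Equiv.refl _).prodCongr (Equiv.sumArrowEquivProdArrow _ _ _)))

theorem bitsEquiv_apply (i : Bits (n + nz + nx)) :
    P.bitsEquiv i = (P.info i, P.testZ i, P.testX i) := rfl

/-- The string with given INFO, TEST-Z and TEST-X substrings. -/
def join (x : Bits n) (t : Bits nz) (u : Bits nx) : Bits (n + nz + nx) :=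
  P.bitsEquiv.symm (x, t, u)

section Join

variable (x : Bits n) (t : Bits nz) (u : Bits nx)

theorem bitsEquiv_join : (P.info (P.join x t u), P.testZ (P.join x t u), P.testX (P.join x t u)) =
    (x, t, u) := by
  rw [← bitsEquiv_apply, join, Equiv.apply_symm_apply]

@[simp] theorem info_join : P.info (P.join x t u) = x := congrArg (·.1) (P.bitsEquiv_join x t u)

@[simp] theorem testZ_join : P.testZ (P.join x t u) = t :=
  congrArg (·.2.1) (P.bitsEquiv_join x t u)

@[simp] theorem testX_join : P.testX (P.join x t u) = u :=
  congrArg (·.2.2) (P.bitsEquiv_join x t u)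

@[simp] theorem join_infoPos (a : Fin n) : P.join x t u (P.infoPos a) = x a :=
  congrFun (P.info_join x t u) a

@[simp] theorem join_testZPos (a : Fin nz) : P.join x t u (P.testZPos a) = t a :=
  congrFun (P.testZ_join x t u) a

@[simp] theorem join_testXPos (a : Fin nx) : P.join x t u (P.testXPos a) = u a :=
  congrFun (P.testX_join x t u) a

theorem sum_join {M : Type*} [AddCommMonoid M] (f : Bits (n + nz + nx) → M) :
    ∑ i, f i = ∑ x, ∑ t, ∑ u, f (P.join x t u) := by
  rw [← Equiv.sum_comp P.bitsEquiv.symm, Fintype.sum_prod_type]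
  simp only [Fintype.sum_prod_type, join]

end Join

end

end Partition

/-! ### Error rates in a random partition -/

section Sampling

variable {α ι : Type*} [Fintype α] [DecidableEq α] [Fintype ι] {n l : ℕ} {s o : ι → Finset α}

theorem card_filter_eq_card_filter_powersetCard (hs : ∀ i, s i ∈ (o i)ᶜ.powersetCard n)
    (hinj : ∀ i j, o i = o j → s i = s j → i = j)
    (hsurj : ∀ i, ∀ A ∈ (o i)ᶜ.powersetCard n, ∃ j, o j = o i ∧ s j = A)
    (q : Finset α → Prop) [DecidablePred q] (i₀ : ι) :
    (Finset.univ.filter fun i => o i = o i₀ ∧ q (s i)).card =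
      (((o i₀)ᶜ.powersetCard n).filter q).card := by
  refine Finset.card_bij (fun i _ => s i) (fun i hi => ?_) (fun i hi j hj h => ?_)
    fun A hA => ?_
  · obtain ⟨hoi, hqi⟩ := (Finset.mem_filter.1 hi).2
    exact Finset.mem_filter.2 ⟨hoi ▸ hs i, hqi⟩
  · exact hinj i j ((Finset.mem_filter.1 hi).2.1.trans (Finset.mem_filter.1 hj).2.1.symm) h
  · obtain ⟨hA, hqA⟩ := Finset.mem_filter.1 hA
    obtain ⟨j, hj, rfl⟩ := hsurj i₀ A hA
    exact ⟨j, Finset.mem_filter.2 ⟨Finset.mem_univ j, hj, hqA⟩, rfl⟩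

theorem card_filter_error_rates_le_mul_card (ho : ∀ i, (o i)ᶜ.card = n + l)
    (hs : ∀ i, s i ∈ (o i)ᶜ.powersetCard n) (hinj : ∀ i j, o i = o j → s i = s j → i = j)
    (hsurj : ∀ i, ∀ A ∈ (o i)ᶜ.powersetCard n, ∃ j, o j = o i ∧ s j = A)
    (W : Finset α) {p ε : ℝ} (hε : 0 ≤ ε) (i₀ : ι) :
    ((Finset.univ.filter fun i => o i = o i₀ ∧ n * (p + ε) ≤ (W ∩ s i).card ∧
        ((W ∩ ((o i)ᶜ \ s i)).card : ℝ) ≤ l * p).card : ℝ) ≤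
      Real.exp (-2 * ((l : ℝ) / (n + l)) ^ 2 * n * ε ^ 2) *
        (Finset.univ.filter fun i => o i = o i₀).card := by
  classical
  have hall := card_filter_eq_card_filter_powersetCard hs hinj hsurj (fun _ => True) i₀
  have hbad := card_filter_eq_card_filter_powersetCard hs hinj hsurj (fun A =>
    n * (p + ε) ≤ (W ∩ (o i₀)ᶜ ∩ A).card ∧ (((W ∩ (o i₀)ᶜ) \ A).card : ℝ) ≤ l * p) i₀
  simp only [and_true, Finset.filter_true, Finset.card_powersetCard, ho] at hall
  rw [hall]
  have hsample := card_filter_error_rates_le (W := W ∩ (o i₀)ᶜ) (p := p) Finset.inter_subset_right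
    (ho i₀) hε
  refine le_of_eq_of_le ?_ (hsample.trans_eq (mul_comm _ _))
  rw [← hbad]
  congr 2
  refine Finset.filter_congr fun i _ => and_congr_right fun hi => ?_
  rw [Finset.inter_assoc, ← hi, Finset.inter_eq_right.2 (Finset.mem_powersetCard.1 (hs i)).1,
    Finset.inter_sdiff_assoc]

/-- Given `o`, the set `s` is a uniformly random sample of the complement of `o`, and the weight
`f` depends on `o` only, so that it does not affect the sampling. -/
theorem sum_filter_error_rates_le (ho : ∀ i, (o i)ᶜ.card = n + l)
    (hs : ∀ i, s i ∈ (o i)ᶜ.powersetCard n) (hinj : ∀ i j, o i = o j → s i = s j → i = j)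
    (hsurj : ∀ i, ∀ A ∈ (o i)ᶜ.powersetCard n, ∃ j, o j = o i ∧ s j = A)
    {f : Finset α → ℝ} (hf : ∀ A, 0 ≤ f A) (W : Finset α) {p ε : ℝ} (hε : 0 ≤ ε) :
    ∑ i with n * (p + ε) ≤ (W ∩ s i).card ∧ ((W ∩ ((o i)ᶜ \ s i)).card : ℝ) ≤ l * p, f (o i) ≤
      Real.exp (-2 * ((l : ℝ) / (n + l)) ^ 2 * n * ε ^ 2) * ∑ i, f (o i) := by
  have hfiber (t : Finset ι) :
      ∑ i ∈ t, f (o i) = ∑ A ∈ Finset.univ.image o, (t.filter (o · = A)).card * f A := by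
    rw [← Finset.sum_fiberwise_of_maps_to fun i _ => Finset.mem_image_of_mem o (Finset.mem_univ i)]
    refine Finset.sum_congr rfl fun A _ => ?_
    rw [← nsmul_eq_mul, ← Finset.sum_const]
    exact Finset.sum_congr rfl fun i hi => congrArg f (Finset.mem_filter.1 hi).2
  rw [hfiber, hfiber, Finset.mul_sum]
  refine Finset.sum_le_sum fun A hA => ?_
  obtain ⟨i₀, -, rfl⟩ := Finset.mem_image.1 hA
  rw [← mul_assoc, Finset.filter_filter]
  refine mul_le_mul_of_nonneg_right ?_ (hf _)
  simpa only [and_comm] using card_filter_error_rates_le_mul_card ho hs hinj hsurj W hε i₀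

end Sampling

namespace Partition

variable {n nz nx : ℕ}

theorem hammingNorm_info (P : Partition n nz nx) (e : Bits (n + nz + nx)) :
    hammingNorm (P.info e) = (supp e ∩ P.infoSet).card := hammingNorm_substring ..

theorem hammingNorm_testZ (P : Partition n nz nx) (e : Bits (n + nz + nx)) :
    hammingNorm (P.testZ e) = (supp e ∩ (P.testXSetᶜ \ P.infoSet)).card := by
  rw [← testZSet_eq]
  exact hammingNorm_substring ..

theorem hammingNorm_testX (P : Partition n nz nx) (e : Bits (n + nz + nx)) :
    hammingNorm (P.testX e) = (supp e ∩ (P.testZSetᶜ \ P.infoSet)).card := by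
  rw [← testXSet_eq]
  exact hammingNorm_substring ..

theorem exists_testXSet_eq_infoSet_eq (P : Partition n nz nx) {A : Finset (Fin (n + nz + nx))}
    (hA : A ∈ P.testXSetᶜ.powersetCard n) :
    ∃ Q : Partition n nz nx, Q.testXSet = P.testXSet ∧ Q.infoSet = A := by
  obtain ⟨hA, hAn⟩ := Finset.mem_powersetCard.1 hA
  obtain ⟨Q, hS, -, hX⟩ := exists_of_disjoint (B := P.testXSetᶜ \ A) hAn
    (by rw [Finset.card_sdiff_of_subset hA, Finset.card_compl, Fintype.card_fin, card_testXSet]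
        omega)
    P.card_testXSet Finset.disjoint_sdiff (Finset.subset_compl_iff_disjoint_right.1 hA)
    (disjoint_compl_left.mono_left Finset.sdiff_subset)
  exact ⟨Q, hX, hS⟩

theorem exists_testZSet_eq_infoSet_eq (P : Partition n nz nx) {A : Finset (Fin (n + nz + nx))}
    (hA : A ∈ P.testZSetᶜ.powersetCard n) :
    ∃ Q : Partition n nz nx, Q.testZSet = P.testZSet ∧ Q.infoSet = A := by
  obtain ⟨hA, hAn⟩ := Finset.mem_powersetCard.1 hA
  obtain ⟨Q, hS, hZ, -⟩ := exists_of_disjoint (C := P.testZSetᶜ \ A) hAn P.card_testZSet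
    (by rw [Finset.card_sdiff_of_subset hA, Finset.card_compl, Fintype.card_fin, card_testZSet]
        omega)
    (Finset.subset_compl_iff_disjoint_right.1 hA) Finset.disjoint_sdiff
    (disjoint_compl_right.mono_right Finset.sdiff_subset)
  exact ⟨Q, hZ, hS⟩

theorem sum_filter_info_testZ_error_rates_le {f : Bits (n + nz + nx) → ℝ} (hf : ∀ b, 0 ≤ f b)
    (e : Bits (n + nz + nx)) {p ε : ℝ} (hε : 0 ≤ ε) :
    ∑ P : Partition n nz nx with n * (p + ε) ≤ hammingNorm (P.info e) ∧
        (hammingNorm (P.testZ e) : ℝ) ≤ nz * p, f P.bases ≤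
      Real.exp (-2 * ((nz : ℝ) / (n + nz)) ^ 2 * n * ε ^ 2) *
        ∑ P : Partition n nz nx, f P.bases := by
  have hbases (P : Partition n nz nx) : P.bases = supp.symm P.testXSet :=
    (supp.symm_apply_apply P.bases).symm
  simp only [hammingNorm_info, hammingNorm_testZ, hbases]
  refine sum_filter_error_rates_le (l := nz) (p := p) (f := fun A => f (supp.symm A))
    (fun P => ?_) (fun P => ?_) (fun P Q hX hS => ext_sets hS ?_ hX)
    (fun P A => P.exists_testXSet_eq_infoSet_eq) (fun A => hf _) (supp e) hε
  · rw [Finset.card_compl, Fintype.card_fin, card_testXSet, Nat.add_sub_cancel]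
  · exact Finset.mem_powersetCard.2
      ⟨Finset.subset_compl_iff_disjoint_right.2 P.disjoint_infoSet_testXSet, P.card_infoSet⟩
  · rw [testZSet_eq, testZSet_eq, hX, hS]

theorem sum_filter_info_testX_error_rates_le {f : Bits (n + nz + nx) → ℝ} (hf : ∀ b, 0 ≤ f b)
    (e : Bits (n + nz + nx)) {p ε : ℝ} (hε : 0 ≤ ε) :
    ∑ P : Partition n nz nx with n * (p + ε) ≤ hammingNorm (P.info e) ∧
        (hammingNorm (P.testX e) : ℝ) ≤ nx * p, f P.conjBases ≤
      Real.exp (-2 * ((nx : ℝ) / (n + nx)) ^ 2 * n * ε ^ 2) *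
        ∑ P : Partition n nz nx, f P.conjBases := by
  have hbases (P : Partition n nz nx) : P.conjBases = supp.symm P.testZSet + 1 :=
    congrArg (· + 1) (supp.symm_apply_apply P.1.2.1).symm
  simp only [hammingNorm_info, hammingNorm_testX, hbases]
  refine sum_filter_error_rates_le (l := nx) (p := p) (f := fun A => f (supp.symm A + 1))
    (fun P => ?_) (fun P => ?_) (fun P Q hZ hS => ext_sets hS hZ ?_)
    (fun P A => P.exists_testZSet_eq_infoSet_eq) (fun A => hf _) (supp e) hε
  · rw [Finset.card_compl, Fintype.card_fin, card_testZSet]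
    omega
  · exact Finset.mem_powersetCard.2
      ⟨Finset.subset_compl_iff_disjoint_right.2 P.disjoint_infoSet_testZSet, P.card_infoSet⟩
  · rw [testXSet_eq, testXSet_eq, hZ, hS]

end Partition

/-! ### Accepted runs -/

section Runs

variable {n nz nx : ℕ}

namespace Partition

variable (P : Partition n nz nx)

theorem info_add (i e : Bits (n + nz + nx)) : P.info (i + e) = P.info i + P.info e := rfl

theorem testZ_add (i e : Bits (n + nz + nx)) : P.testZ (i + e) = P.testZ i + P.testZ e := rfl

theorem testX_add (i e : Bits (n + nz + nx)) : P.testX (i + e) = P.testX i + P.testX e := rfl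

theorem testPassed_add {pz px : ℝ} (i e : Bits (n + nz + nx)) :
    P.TestPassed pz px i (i + e) ↔ P.TestPassed pz px 0 e := by
  rw [TestPassed, TestPassed, zero_add, ← add_assoc, ZModModule.add_self, zero_add]

theorem testPassed_join {pz px : ℝ} (x y : Bits n) (t τ : Bits nz) (u υ : Bits nx) :
    P.TestPassed pz px (P.join x t u) (P.join y (t + τ) (u + υ)) ↔
      (hammingNorm τ : ℝ) / nz ≤ pz ∧ (hammingNorm υ : ℝ) / nx ≤ px := by
  rw [TestPassed, testZ_add, testX_add, testZ_join, testZ_join, testX_join, testX_join,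
    ← add_assoc, ← add_assoc, ZModModule.add_self, ZModModule.add_self, zero_add, zero_add]

end Partition

variable {M : Type*} [AddCommMonoid M] (pz px : ℝ)

open scoped Classical in
/-- The runs `(𝒫, i, iB)` of the protocol in which the test is passed. -/
def acceptedRuns : Finset (Partition n nz nx × Bits (n + nz + nx) × Bits (n + nz + nx)) :=
  Finset.univ.filter fun ω => ω.1.TestPassed pz px ω.2.1 ω.2.2

open scoped Classical in
theorem sum_acceptedRuns
    (f : Partition n nz nx → Bits (n + nz + nx) → Bits (n + nz + nx) → M) :
    ∑ ω ∈ acceptedRuns pz px, f ω.1 ω.2.1 ω.2.2 =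
      ∑ P, ∑ i, ∑ iB, if P.TestPassed pz px i iB then f P i iB else 0 := by
  rw [acceptedRuns, Finset.sum_filter, Fintype.sum_prod_type]
  simp only [Fintype.sum_prod_type]

open scoped Classical in
theorem sum_acceptedRuns_add
    (f : Partition n nz nx → Bits (n + nz + nx) → Bits (n + nz + nx) → M) :
    ∑ ω ∈ acceptedRuns pz px, f ω.1 ω.2.1 ω.2.2 =
      ∑ P : Partition n nz nx, ∑ e with P.TestPassed pz px 0 e, ∑ i, f P i (i + e) := by
  rw [sum_acceptedRuns]
  refine Finset.sum_congr rfl fun P _ => ?_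
  conv_rhs => rw [Finset.sum_comm]
  refine Finset.sum_congr rfl fun i _ => ?_
  rw [Finset.sum_filter, ← Equiv.sum_comp (Equiv.addLeft i)]
  simp only [Equiv.coe_addLeft, P.testPassed_add]

open scoped Classical in
/-- The TEST bits sent by Alice together with the errors on them, for which the test is passed. -/
def acceptedTests (nz nx : ℕ) (pz px : ℝ) : Finset (Bits nz × Bits nx × Bits nz × Bits nx) :=
  Finset.univ.filter fun d =>
    (hammingNorm d.2.2.1 : ℝ) / nz ≤ pz ∧ (hammingNorm d.2.2.2 : ℝ) / nx ≤ px

theorem sum_acceptedRuns_join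
    (f : Partition n nz nx → Bits (n + nz + nx) → Bits (n + nz + nx) → M) :
    ∑ ω ∈ acceptedRuns pz px, f ω.1 ω.2.1 ω.2.2 =
      ∑ P : Partition n nz nx, ∑ d ∈ acceptedTests nz nx pz px, ∑ x, ∑ y,
        f P (P.join x d.1 d.2.1) (P.join y (d.1 + d.2.2.1) (d.2.1 + d.2.2.2)) := by
  classical
  rw [sum_acceptedRuns]
  refine Finset.sum_congr rfl fun P _ => ?_
  simp only [acceptedTests, Finset.sum_filter, Fintype.sum_prod_type]
  rw [P.sum_join, Finset.sum_comm]
  refine Finset.sum_congr rfl fun t _ => ?_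
  rw [Finset.sum_comm]
  refine Finset.sum_congr rfl fun u _ => ?_
  have hx (x : Bits n) : ∑ iB, (if P.TestPassed pz px (P.join x t u) iB then
      f P (P.join x t u) iB else 0) = ∑ τ : Bits nz, ∑ υ : Bits nx,
        if (hammingNorm τ : ℝ) / nz ≤ pz ∧ (hammingNorm υ : ℝ) / nx ≤ px then
          ∑ y, f P (P.join x t u) (P.join y (t + τ) (u + υ)) else 0 := by
    rw [P.sum_join, Finset.sum_comm, ← Equiv.sum_comp (Equiv.addLeft t)]
    refine Finset.sum_congr rfl fun τ _ => ?_
    rw [Finset.sum_comm, ← Equiv.sum_comp (Equiv.addLeft u)]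
    refine Finset.sum_congr rfl fun υ _ => ?_
    simp only [Equiv.coe_addLeft, P.testPassed_join]
    split_ifs
    · rfl
    · exact Finset.sum_const_zero
  simp only [hx]
  rw [Finset.sum_comm]
  refine Finset.sum_congr rfl fun τ _ => ?_
  rw [Finset.sum_comm]
  refine Finset.sum_congr rfl fun υ _ => ?_
  split_ifs
  · rfl
  · exact Finset.sum_const_zero

end Runs

/-! ### Undetected errors -/

namespace CollectiveAttack

variable {n nz nx : ℕ} (𝒜 : CollectiveAttack (n + nz + nx))

theorem sum_filter_errDist_le {b : Partition n nz nx → Bits (n + nz + nx)}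
    {T : Partition n nz nx → Bits (n + nz + nx) → Prop} [∀ P e, Decidable (T P e)] {C : ℝ}
    (hT : ∀ e, ∑ P with T P e, 𝒜.errDist (b P) e ≤ C * ∑ P, 𝒜.errDist (b P) e) :
    ∑ P, ∑ e with T P e, 𝒜.errDist (b P) e ≤ C * Fintype.card (Partition n nz nx) := by
  calc
    _ = ∑ e, ∑ P with T P e, 𝒜.errDist (b P) e := by
      simp only [Finset.sum_filter]
      exact Finset.sum_comm
    _ ≤ ∑ e, C * ∑ P, 𝒜.errDist (b P) e := Finset.sum_le_sum fun e _ => hT e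
    _ = C * ∑ P, ∑ e, 𝒜.errDist (b P) e := by rw [← Finset.mul_sum, Finset.sum_comm]
    _ = _ := by simp only [sum_errDist, Finset.sum_const, nsmul_one, Finset.card_univ]

open scoped Classical in
theorem sum_errDist_bases_le (hnz : 0 < nz) {pz px ε : ℝ} (hε : 0 ≤ ε) :
    ∑ P : Partition n nz nx, ∑ e with P.TestPassed pz px 0 e ∧
        n * (pz + ε) ≤ hammingNorm (P.info e), 𝒜.errDist P.bases e ≤
      Real.exp (-2 * ((nz : ℝ) / (n + nz)) ^ 2 * n * ε ^ 2) *
        Fintype.card (Partition n nz nx) := by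
  refine 𝒜.sum_filter_errDist_le (b := Partition.bases) (T := fun P e =>
    P.TestPassed pz px 0 e ∧ n * (pz + ε) ≤ hammingNorm (P.info e)) fun e => ?_
  refine (Finset.sum_le_sum_of_subset_of_nonneg ?_ fun P _ _ => 𝒜.errDist_nonneg _ _).trans
    (Partition.sum_filter_info_testZ_error_rates_le (p := pz) (𝒜.errDist_nonneg · e) e hε)
  refine Finset.monotone_filter_right _ fun P _ ⟨htest, hinfo⟩ => ⟨hinfo, ?_⟩
  exact (div_le_iff₀' (Nat.cast_pos.2 hnz)).1 (by simpa only [zero_add] using htest.1)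

open scoped Classical in
theorem sum_errDist_conjBases_le (hnx : 0 < nx) {pz px ε : ℝ} (hε : 0 ≤ ε) :
    ∑ P : Partition n nz nx, ∑ e with P.TestPassed pz px 0 e ∧
        n * (px + ε) ≤ hammingNorm (P.info e), 𝒜.errDist P.conjBases e ≤
      Real.exp (-2 * ((nx : ℝ) / (n + nx)) ^ 2 * n * ε ^ 2) *
        Fintype.card (Partition n nz nx) := by
  refine 𝒜.sum_filter_errDist_le (b := Partition.conjBases) (T := fun P e =>
    P.TestPassed pz px 0 e ∧ n * (px + ε) ≤ hammingNorm (P.info e)) fun e => ?_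
  refine (Finset.sum_le_sum_of_subset_of_nonneg ?_ fun P _ _ => 𝒜.errDist_nonneg _ _).trans
    (Partition.sum_filter_info_testX_error_rates_le (p := px) (𝒜.errDist_nonneg · e) e hε)
  refine Finset.monotone_filter_right _ fun P _ ⟨htest, hinfo⟩ => ⟨hinfo, ?_⟩
  exact (div_le_iff₀' (Nat.cast_pos.2 hnx)).1 (by simpa only [zero_add] using htest.2)

end CollectiveAttack

/-! ### Reliability -/

open scoped Classical in
theorem sum_outcomeProb_bobKey_ne_key_le {n nz nx : ℕ} (𝒜 : CollectiveAttack (n + nz + nx))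
    (K : Code n) (hnz : 0 < nz) {pz px ε : ℝ} (hε : 0 ≤ ε) (hK : K.CorrectsErrors (n * (pz + ε))) :
    ∑ ω ∈ acceptedRuns pz px with
        K.bobKey (ω.1.info ω.2.2) (K.syndrome (ω.1.info ω.2.1)) ≠ K.key (ω.1.info ω.2.1),
        𝒜.outcomeProb ω.1.bases ω.2.1 ω.2.2 ≤
      2 ^ (n + nz + nx) * (Real.exp (-2 * ((nz : ℝ) / (n + nz)) ^ 2 * n * ε ^ 2) *
        Fintype.card (Partition n nz nx)) := by
  have hterm (P : Partition n nz nx) (i e : Bits (n + nz + nx)) :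
      (if K.bobKey (P.info (i + e)) (K.syndrome (P.info i)) ≠ K.key (P.info i) then
        𝒜.outcomeProb P.bases i (i + e) else 0) ≤
      if n * (pz + ε) ≤ hammingNorm (P.info e) then 𝒜.outcomeProb P.bases i (i + e) else 0 := by
    have hnonneg : 0 ≤ 𝒜.outcomeProb P.bases i (i + e) := normSq_nonneg _
    by_cases he : n * (pz + ε) ≤ hammingNorm (P.info e)
    · rw [if_pos he]
      split_ifs <;> linarith
    · have hdist : hammingDist (P.info i) (P.info (i + e)) = hammingNorm (P.info e) := by
        rw [hammingDist_eq_hammingNorm, P.info_add, neg_add_cancel_left]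
      have hdec : K.bobKey (P.info (i + e)) (K.syndrome (P.info i)) = K.key (P.info i) :=
        congrArg K.key (hK _ _ (by rw [hdist]; exact (not_le.1 he).le))
      rw [if_neg he, if_neg (not_not.2 hdec)]
  rw [Finset.sum_filter, sum_acceptedRuns_add pz px fun P i iB =>
    if K.bobKey (P.info iB) (K.syndrome (P.info i)) ≠ K.key (P.info i) then
      𝒜.outcomeProb P.bases i iB else 0]
  calc
    _ ≤ ∑ P : Partition n nz nx, ∑ e with P.TestPassed pz px 0 e, ∑ i,
        if n * (pz + ε) ≤ hammingNorm (P.info e) then 𝒜.outcomeProb P.bases i (i + e) else 0 :=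
      Finset.sum_le_sum fun P _ => Finset.sum_le_sum fun e _ => Finset.sum_le_sum fun i _ =>
        hterm P i e
    _ = 2 ^ (n + nz + nx) * ∑ P : Partition n nz nx, ∑ e with P.TestPassed pz px 0 e ∧
        n * (pz + ε) ≤ hammingNorm (P.info e), 𝒜.errDist P.bases e := by
      rw [Finset.mul_sum]
      refine Finset.sum_congr rfl fun P _ => ?_
      rw [Finset.mul_sum, ← Finset.filter_filter, Finset.sum_filter (s := Finset.filter _ _)]
      refine Finset.sum_congr rfl fun e _ => ?_
      rw [← 𝒜.sum_outcomeProb_add]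
      split_ifs
      · rfl
      · exact Finset.sum_const_zero
    _ ≤ _ := mul_le_mul_of_nonneg_left (𝒜.sum_errDist_bases_le hnz hε) (by positivity)

/-! ### Secrecy -/

section Secrecy

variable {n nz nx : ℕ}

theorem sum_sqrt_mul_sqrt_le_mul {ι : Type*} {s : Finset ι} {f g : ι → ℝ} {c q : ℝ}
    (hf : ∀ i, 0 ≤ f i) (hg : ∀ i, 0 ≤ g i) (hc : 0 ≤ c) (hfq : ∑ i ∈ s, f i ≤ q)
    (hgq : ∑ i ∈ s, g i ≤ c ^ 2 * q) : ∑ i ∈ s, √(f i) * √(g i) ≤ c * q := by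
  have hq : 0 ≤ q := (Finset.sum_nonneg fun i _ => hf i).trans hfq
  calc
    _ ≤ √q * √(c ^ 2 * q) :=
      (Real.sum_sqrt_mul_sqrt_le s hf hg).trans (by gcongr)
    _ = c * q := by
      rw [Real.sqrt_mul (sq_nonneg c), Real.sqrt_sq hc, mul_left_comm, Real.mul_self_sqrt hq]

theorem Partition.normSq_prod_position (P : Partition n nz nx) {κ : Fin (n + nz + nx) → Type*}
    [∀ j, Fintype (κ j)] (f : ∀ k, κ (P.infoPos k) → ℂ) (g : ∀ k, κ (P.testZPos k) → ℂ)
    (h : ∀ k, κ (P.testXPos k) → ℂ) :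
    normSq (fun e : ∀ j, κ j => (∏ k, f k (e (P.infoPos k))) *
        ((∏ k, g k (e (P.testZPos k))) * ∏ k, h k (e (P.testXPos k)))) =
      (∏ k, normSq (f k)) * ((∏ k, normSq (g k)) * ∏ k, normSq (h k)) := by
  obtain ⟨φ, hf, hg, hh⟩ : ∃ φ : ∀ j, κ j → ℂ, (∀ k, φ (P.infoPos k) = f k) ∧
      (∀ k, φ (P.testZPos k) = g k) ∧ ∀ k, φ (P.testXPos k) = h k :=
    let φ := Equiv.piCongrLeft (fun j => κ j → ℂ) P.positionEquiv
      (Sum.rec f (Sum.rec g h))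
    ⟨φ, fun k => Equiv.piCongrLeft_apply_apply _ P.positionEquiv _ (.inl k),
      fun k => Equiv.piCongrLeft_apply_apply _ P.positionEquiv _ (.inr (.inl k)),
      fun k => Equiv.piCongrLeft_apply_apply _ P.positionEquiv _ (.inr (.inr k))⟩
  simp only [← hf, ← hg, ← hh]
  rw [← P.prod_position fun j => normSq (φ j), ← normSq_prod]
  congr 1
  funext e
  exact (P.prod_position fun j => φ j (e j)).symm

namespace CollectiveAttack

variable (𝒜 : CollectiveAttack (n + nz + nx)) (P : Partition n nz nx)

theorem eveVec_join (x y : Bits n) (t t' : Bits nz) (u u' : Bits nx) (e : 𝒜.Probe) :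
    𝒜.eveVec P.bases (P.join x t u) (P.join y t' u') e =
      (∏ k, 𝒜.probeVec (P.infoPos k) 0 (x k) (y k) (e (P.infoPos k))) *
        ((∏ k, 𝒜.probeVec (P.testZPos k) 0 (t k) (t' k) (e (P.testZPos k))) *
          ∏ k, 𝒜.probeVec (P.testXPos k) 1 (u k) (u' k) (e (P.testXPos k))) := by
  rw [eveVec, P.prod_position]
  simp only [P.bases_infoPos, P.bases_testZPos, P.bases_testXPos, P.join_infoPos,
    P.join_testZPos, P.join_testXPos]

theorem fourier_eveVec_join (c a : Bits n) (t t' : Bits nz) (u u' : Bits nx) :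
    fourier (fun x => 𝒜.eveVec P.bases (P.join x t u) (P.join (x + c) t' u')) a =
      fun e => (∏ k, ((1 / 2 : ℂ) • ∑ x, sgn (a k * x) •
          𝒜.probeVec (P.infoPos k) 0 x (x + c k)) (e (P.infoPos k))) *
        ((∏ k, 𝒜.probeVec (P.testZPos k) 0 (t k) (t' k) (e (P.testZPos k))) *
          ∏ k, 𝒜.probeVec (P.testXPos k) 1 (u k) (u' k) (e (P.testXPos k))) := by
  funext e
  simp only [fourier, Pi.smul_apply, Finset.sum_apply, smul_eq_mul, eveVec_join]
  rw [Finset.prod_mul_distrib, Fintype.prod_sum, Finset.prod_const, Finset.card_univ,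
    Fintype.card_fin, one_div, inv_pow, mul_assoc, Finset.sum_mul]
  congr 1
  refine Finset.sum_congr rfl fun x _ => ?_
  rw [Finset.prod_mul_distrib, ← sgn_sum, mul_assoc]
  rfl

/-- The Fourier transform on the INFO bits turns the attack on the protocol into the attack on
the protocol in which the INFO bits are sent in the `x` basis. -/
theorem sum_normSq_fourier_eveVec (a : Bits n) (τ : Bits nz) (υ : Bits nx) :
    ∑ t, ∑ u, ∑ c, normSq (fourier (fun x =>
        𝒜.eveVec P.bases (P.join x t u) (P.join (x + c) (t + τ) (u + υ))) a) =
      2 ^ nz * 2 ^ nx * 𝒜.errDist P.conjBases (P.join a τ υ) := by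
  have hinfo : ∏ k, 𝒜.errProb (P.infoPos k) 1 (a k) = ∑ c : Bits n, ∏ k,
      normSq ((1 / 2 : ℂ) • ∑ x, sgn (a k * x) • 𝒜.probeVec (P.infoPos k) 0 x (x + c k)) := by
    simp only [errProb_one_eq_sum_normSq]
    exact Fintype.prod_sum fun k s =>
      normSq ((1 / 2 : ℂ) • ∑ x, sgn (a k * x) • 𝒜.probeVec (P.infoPos k) 0 x (x + s))
  have htestZ := 𝒜.sum_prod_normSq_probeVec P.testZPos 0 τ
  have htestX := 𝒜.sum_prod_normSq_probeVec P.testXPos 1 υ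
  simp only [Fintype.card_fin, Pi.zero_apply, Pi.one_apply] at htestZ htestX
  rw [errDist, P.prod_position]
  simp only [P.conjBases_infoPos, P.conjBases_testZPos, P.conjBases_testXPos, P.join_infoPos,
    P.join_testZPos, P.join_testXPos, fourier_eveVec_join, P.normSq_prod_position]
  simp only [← Finset.sum_mul, ← Finset.mul_sum, Pi.add_apply, htestX, htestZ, ← hinfo]
  ring

open scoped Classical in
theorem sum_acceptedTests_normSq_fourier_eveVec (pz px : ℝ) (s : Finset (Bits n)) :
    ∑ d ∈ acceptedTests nz nx pz px, ∑ c, ∑ a ∈ s, normSq (fourier (fun x =>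
        𝒜.eveVec P.bases (P.join x d.1 d.2.1)
          (P.join (x + c) (d.1 + d.2.2.1) (d.2.1 + d.2.2.2))) a) =
      2 ^ nz * 2 ^ nx *
        ∑ e with P.TestPassed pz px 0 e ∧ P.info e ∈ s, 𝒜.errDist P.conjBases e := by
  let errors : Finset (Bits nz × Bits nx) := Finset.univ.filter fun d =>
    (hammingNorm d.1 : ℝ) / nz ≤ pz ∧ (hammingNorm d.2 : ℝ) / nx ≤ px
  have htests : acceptedTests nz nx pz px = Finset.univ ×ˢ Finset.univ ×ˢ errors := by
    ext d
    simp [acceptedTests, errors]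
  have hpassed (a : Bits n) (d : Bits nz × Bits nx) :
      P.TestPassed pz px 0 (P.join a d.1 d.2) ∧ P.info (P.join a d.1 d.2) ∈ s ↔
        a ∈ s ∧ d ∈ errors := by
    rw [Partition.TestPassed, zero_add, P.info_join, P.testZ_join, P.testX_join, and_comm,
      Finset.mem_filter_univ]
  have herrors : ∑ e with P.TestPassed pz px 0 e ∧ P.info e ∈ s, 𝒜.errDist P.conjBases e =
      ∑ a ∈ s, ∑ d ∈ errors, 𝒜.errDist P.conjBases (P.join a d.1 d.2) := by
    rw [← Finset.sum_product', ← Finset.univ_inter (s ×ˢ errors),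
      ← Finset.filter_mem_eq_inter, Finset.sum_filter, Finset.sum_filter, P.sum_join]
    simp only [Fintype.sum_prod_type, ← hpassed, Finset.mem_product]
  rw [htests, herrors, Finset.mul_sum]
  simp only [Finset.sum_product, Finset.mul_sum, ← sum_normSq_fourier_eveVec,
    Finset.sum_comm (s := errors)]
  simp only [Finset.sum_comm (t := s)]

theorem sum_normSq_fourier_eveVec_le (pz px : ℝ) :
    ∑ P : Partition n nz nx, ∑ d ∈ acceptedTests nz nx pz px, ∑ c, ∑ a,
        normSq (fourier (fun x => 𝒜.eveVec P.bases (P.join x d.1 d.2.1)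
          (P.join (x + c) (d.1 + d.2.2.1) (d.2.1 + d.2.2.2))) a) ≤
      2 ^ nz * 2 ^ nx * Fintype.card (Partition n nz nx) := by
  classical
  simp only [sum_acceptedTests_normSq_fourier_eveVec, ← Finset.mul_sum]
  refine mul_le_mul_of_nonneg_left ?_ (by positivity)
  calc
    _ ≤ ∑ P : Partition n nz nx, ∑ e, 𝒜.errDist P.conjBases e :=
      Finset.sum_le_sum fun P _ => Finset.sum_le_sum_of_subset_of_nonneg
        (Finset.filter_subset _ _) fun e _ _ => 𝒜.errDist_nonneg _ _
    _ = _ := by simp only [sum_errDist, Finset.sum_const, nsmul_one, Finset.card_univ]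

theorem sum_filter_normSq_fourier_eveVec_le (hnx : 0 < nx) (pz : ℝ) {px ε : ℝ} (hε : 0 ≤ ε)
    {D : ℕ} (hD : n * (px + ε) ≤ D / 2) :
    ∑ P : Partition n nz nx, ∑ d ∈ acceptedTests nz nx pz px, ∑ c,
        ∑ a with D ≤ 2 * hammingNorm a,
        normSq (fourier (fun x => 𝒜.eveVec P.bases (P.join x d.1 d.2.1)
          (P.join (x + c) (d.1 + d.2.2.1) (d.2.1 + d.2.2.2))) a) ≤
      2 ^ nz * 2 ^ nx * (Real.exp (-2 * ((nx : ℝ) / (n + nx)) ^ 2 * n * ε ^ 2) *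
        Fintype.card (Partition n nz nx)) := by
  classical
  simp only [sum_acceptedTests_normSq_fourier_eveVec, ← Finset.mul_sum]
  refine mul_le_mul_of_nonneg_left
    (le_trans ?_ (𝒜.sum_errDist_conjBases_le (pz := pz) (px := px) hnx hε)) (by positivity)
  refine Finset.sum_le_sum fun P _ => Finset.sum_le_sum_of_subset_of_nonneg ?_
    fun e _ _ => 𝒜.errDist_nonneg _ _
  refine Finset.monotone_filter_right _ fun e _ ⟨htest, hinfo⟩ => ⟨htest, ?_⟩
  have hweight : (D : ℝ) ≤ 2 * hammingNorm (P.info e) :=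
    mod_cast (Finset.mem_filter_univ (P.info e)).1 hinfo
  linarith

end CollectiveAttack

open scoped Classical in
theorem norm_sum_acceptedRuns_keyDefect_le (𝒜 : CollectiveAttack (n + nz + nx)) {K : Code n}
    (hK : LinearIndependent (ZMod 2) K.rows) (hnx : 0 < nx) {pz px ε : ℝ}
    (hε : 0 ≤ ε) (hd : n * (px + ε) ≤ K.dist / 2)
    {B : Bits K.m → Public K nz nx → Matrix 𝒜.Probe 𝒜.Probe ℂ} (hB : ∀ κ w, ‖B κ w‖ ≤ 1) :
    ‖∑ ω ∈ acceptedRuns pz px, star (𝒜.eveVec ω.1.bases ω.2.1 ω.2.2) ⬝ᵥ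
        K.keyDefect (fun κ ξ => B κ ((ω.1.testZ ω.2.1, ω.1.testX ω.2.1, ω.1.testZ ω.2.2,
          ω.1.testX ω.2.2), ω.1, ξ)) (ω.1.info ω.2.1) *ᵥ 𝒜.eveVec ω.1.bases ω.2.1 ω.2.2‖ ≤
      4 * 2 ^ (n + nz + nx) * (Real.exp (-((nx : ℝ) / (n + nx)) ^ 2 * n * ε ^ 2) *
        Fintype.card (Partition n nz nx)) := by
  set z := -((nx : ℝ) / (n + nx)) ^ 2 * n * ε ^ 2 with hz
  set q : ℝ := 2 ^ nz * 2 ^ nx * Fintype.card (Partition n nz nx) with hq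
  let W (s : Finset (Bits n)) (v : Partition n nz nx × Bits nz × Bits nx × Bits nz × Bits nx) : ℝ :=
    ∑ c, ∑ a ∈ s, normSq (fourier (fun x => 𝒜.eveVec v.1.bases (v.1.join x v.2.1 v.2.2.1)
      (v.1.join (x + c) (v.2.1 + v.2.2.2.1) (v.2.2.1 + v.2.2.2.2))) a)
  let high : Finset (Bits n) := {a | K.dist ≤ 2 * hammingNorm a}
  have hW_nonneg s v : 0 ≤ W s v :=
    Finset.sum_nonneg fun _ _ => Finset.sum_nonneg fun _ _ => normSq_nonneg _
  have hall : ∑ v ∈ Finset.univ ×ˢ acceptedTests nz nx pz px, W Finset.univ v ≤ q := by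
    rw [Finset.sum_product]
    exact 𝒜.sum_normSq_fourier_eveVec_le pz px
  have hhigh : ∑ v ∈ Finset.univ ×ˢ acceptedTests nz nx pz px, W high v ≤ Real.exp z ^ 2 * q := by
    rw [Finset.sum_product]
    refine (𝒜.sum_filter_normSq_fourier_eveVec_le hnx pz hε hd).trans_eq ?_
    rw [← Real.exp_nat_mul, hz, hq]
    push_cast
    ring_nf
  rw [sum_acceptedRuns_join pz px fun P i iB => star (𝒜.eveVec P.bases i iB) ⬝ᵥ
    K.keyDefect (fun κ ξ => B κ ((P.testZ i, P.testX i, P.testZ iB, P.testX iB), P, ξ))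
      (P.info i) *ᵥ 𝒜.eveVec P.bases i iB, ← Finset.sum_product']
  simp only [Partition.info_join, Partition.testZ_join, Partition.testX_join]
  calc
    _ ≤ ∑ v ∈ Finset.univ ×ˢ acceptedTests nz nx pz px,
        4 * 2 ^ n * (√(W Finset.univ v) * √(W high v)) :=
      norm_sum_le_of_le _ fun v _ => Code.norm_sum_sum_keyDefect_quadratic_form_le hK
        (fun κ ξ => hB κ ((v.2.1, v.2.2.1, v.2.1 + v.2.2.2.1, v.2.2.1 + v.2.2.2.2), v.1, ξ))
        fun x y => 𝒜.eveVec v.1.bases (v.1.join x v.2.1 v.2.2.1)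
          (v.1.join y (v.2.1 + v.2.2.2.1) (v.2.2.1 + v.2.2.2.2))
    _ ≤ 4 * 2 ^ n * (Real.exp z * q) := by
      rw [← Finset.mul_sum]
      gcongr
      exact sum_sqrt_mul_sqrt_le_mul (hW_nonneg _) (hW_nonneg _) (Real.exp_nonneg z) hall hhigh
    _ = _ := by ring

end Secrecy

/-! ### The final state -/

section Blocks

variable {α β F Ω : Type*}

/-- The block of an operator that acts on the quantum system `F` when the classical registers
before and after it hold `a` and `w`. -/
def diagBlock (S : Matrix (α × (F × Ω)) (α × (F × Ω)) ℂ) (a : α) (w : Ω) : Matrix F F ℂ :=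
  S.submatrix (fun e => (a, (e, w))) fun e => (a, (e, w))

theorem proj_apply [DecidableEq α] (a b c : α) :
    proj a b c = if a = b ∧ a = c then 1 else 0 :=
  Matrix.single_apply ..

theorem proj_kronecker_proj [DecidableEq α] [DecidableEq β] (a : α) (b : β) :
    proj a ⊗ₖ proj b = proj (a, b) := by
  simp [proj, Matrix.single_kronecker_single]

theorem sum_kronecker {ι : Type*} (s : Finset ι) (M : ι → Matrix α α ℂ) (M' : Matrix β β ℂ) :
    (∑ k ∈ s, M k) ⊗ₖ M' = ∑ k ∈ s, M k ⊗ₖ M' := by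
  ext
  simp [Matrix.sum_apply, Finset.sum_mul]

theorem kronecker_sum {ι : Type*} (s : Finset ι) (M : Matrix α α ℂ) (M' : ι → Matrix β β ℂ) :
    M ⊗ₖ (∑ k ∈ s, M' k) = ∑ k ∈ s, M ⊗ₖ M' k := by
  ext
  simp [Matrix.sum_apply, Finset.mul_sum]

theorem partialTraceLeft_smul_sum_proj_kronecker [Fintype α] [DecidableEq α] {ι : Type*}
    (c : ℂ) (s : Finset ι) (a : ι → α) (M : ι → Matrix β β ℂ) :
    partialTraceLeft (c • ∑ k ∈ s, proj (a k) ⊗ₖ M k) = c • ∑ k ∈ s, M k := by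
  ext e e'
  simp only [partialTraceLeft, Matrix.smul_apply, Matrix.sum_apply, Matrix.kroneckerMap_apply,
    proj_apply, and_self, ite_mul, one_mul, zero_mul, ← Finset.smul_sum]
  rw [Finset.sum_comm]
  simp

variable [Fintype α] [Fintype F] [Fintype Ω] [DecidableEq α] [DecidableEq Ω]

theorem norm_diagBlock_le [DecidableEq F] (S : Matrix (α × (F × Ω)) (α × (F × Ω)) ℂ) (a : α)
    (w : Ω) : ‖diagBlock S a w‖ ≤ ‖S‖ :=
  norm_submatrix_le (fun e e' h => by simpa using h) S

theorem trace_mul_proj_kronecker (S : Matrix (α × (F × Ω)) (α × (F × Ω)) ℂ) (a : α) (w : Ω)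
    (M : Matrix F F ℂ) :
    (S * (proj a ⊗ₖ (M ⊗ₖ proj w))).trace = (diagBlock S a w * M).trace := by
  simp [Matrix.trace, Matrix.mul_apply, Fintype.sum_prod_type, proj_apply, diagBlock, ite_and]

end Blocks

section State

variable {n nz nx : ℕ} (K : Code n) (pz px : ℝ) (𝒜 : CollectiveAttack (n + nz + nx))

/-- The probability of each pair of a partition and a string sent by Alice. -/
def runWeight (n nz nx : ℕ) : ℝ :=
  (1 / (Fintype.card (Partition n nz nx) : ℝ)) * (1 / 2 ^ (n + nz + nx))

theorem runWeight_nonneg (n nz nx : ℕ) : 0 ≤ runWeight n nz nx := by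
  rw [runWeight]
  positivity

theorem runWeight_mul_le_one (n nz nx : ℕ) :
    runWeight n nz nx * (2 ^ (n + nz + nx) * Fintype.card (Partition n nz nx)) ≤ 1 := by
  calc
    _ = (Fintype.card (Partition n nz nx) : ℝ) / Fintype.card (Partition n nz nx) := by
      rw [runWeight]
      field_simp
    _ ≤ 1 := div_self_le_one _

theorem jointProb_smul_eveState (P : Partition n nz nx) (i iB : Bits (n + nz + nx)) :
    (jointProb nz nx 𝒜 i iB P : ℂ) • 𝒜.eveState P.bases i iB =
      (runWeight n nz nx : ℂ) •
        Matrix.vecMulVec (𝒜.eveVec P.bases i iB) (star (𝒜.eveVec P.bases i iB)) := by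
  have hjoint : jointProb nz nx 𝒜 i iB P = runWeight n nz nx * 𝒜.outcomeProb P.bases i iB := rfl
  rw [CollectiveAttack.eveState, smul_smul, hjoint]
  by_cases h : 𝒜.outcomeProb P.bases i iB = 0
  · simp [normSq_eq_zero.1 h]
  · rw [Complex.ofReal_mul, mul_assoc, mul_inv_cancel₀ (Complex.ofReal_ne_zero.2 h), mul_one]

/-- The state of Eve's system in a given run, with the probes normalized to have trace
`outcomeProb`. -/
def runState (P : Partition n nz nx) (i iB : Bits (n + nz + nx)) :
    Matrix (𝒜.Probe × Public K nz nx) (𝒜.Probe × Public K nz nx) ℂ :=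
  Matrix.vecMulVec (𝒜.eveVec P.bases i iB) (star (𝒜.eveVec P.bases i iB)) ⊗ₖ
    proj (published K nz nx P i iB)

theorem rhoABE_eq : rhoABE K nz nx pz px 𝒜 = (runWeight n nz nx : ℂ) • ∑ ω ∈ acceptedRuns pz px,
    proj (K.key (ω.1.info ω.2.1), K.bobKey (ω.1.info ω.2.2) (K.syndrome (ω.1.info ω.2.1))) ⊗ₖ
      runState K 𝒜 ω.1 ω.2.1 ω.2.2 := by
  rw [rhoABE, ← sum_acceptedRuns pz px, Finset.smul_sum]
  refine Finset.sum_congr rfl fun ω _ => ?_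
  rw [← Matrix.kronecker_smul, ← Matrix.smul_kronecker, jointProb_smul_eveState,
    Matrix.smul_kronecker, Matrix.kronecker_smul, proj_kronecker_proj]
  rfl

theorem rhoE_eq : rhoE K nz nx pz px 𝒜 =
    (runWeight n nz nx : ℂ) • ∑ ω ∈ acceptedRuns pz px, runState K 𝒜 ω.1 ω.2.1 ω.2.2 := by
  rw [rhoE, rhoABE_eq, partialTraceLeft_smul_sum_proj_kronecker]

theorem rhoU_kronecker_rhoE_eq : rhoU K ⊗ₖ rhoE K nz nx pz px 𝒜 =
    (runWeight n nz nx : ℂ) • ∑ ω ∈ acceptedRuns pz px,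
      (2 ^ K.m : ℂ)⁻¹ • ∑ κ, proj (κ, κ) ⊗ₖ runState K 𝒜 ω.1 ω.2.1 ω.2.2 := by
  rw [rhoE_eq, Matrix.kronecker_smul, kronecker_sum, rhoU]
  simp only [Matrix.smul_kronecker, sum_kronecker, proj_kronecker_proj, one_div]

theorem isHermitian_runState (P : Partition n nz nx) (i iB : Bits (n + nz + nx)) :
    (runState K 𝒜 P i iB).IsHermitian := by
  rw [Matrix.IsHermitian, runState, Matrix.conjTranspose_kronecker, Matrix.conjTranspose_vecMulVec,
    star_star, isHermitian_proj]

theorem isHermitian_rhoABE : (rhoABE K nz nx pz px 𝒜).IsHermitian := by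
  rw [rhoABE_eq, Matrix.IsHermitian]
  simp only [Matrix.conjTranspose_smul, Matrix.conjTranspose_sum, Matrix.conjTranspose_kronecker,
    (isHermitian_proj _).eq, (isHermitian_runState _ _ _ _ _).eq, Complex.star_def,
    Complex.conj_ofReal]

theorem isHermitian_rhoU_kronecker_rhoE :
    (rhoU K ⊗ₖ rhoE K nz nx pz px 𝒜).IsHermitian := by
  rw [rhoU_kronecker_rhoE_eq, Matrix.IsHermitian]
  simp only [Matrix.conjTranspose_smul, Matrix.conjTranspose_sum, Matrix.conjTranspose_kronecker,
    (isHermitian_proj _).eq, (isHermitian_runState _ _ _ _ _).eq, Complex.star_def,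
    Complex.conj_ofReal, star_inv₀, star_pow, star_ofNat]

variable {K 𝒜}

/-- The unnormalized expectation in a given run of the block of an observable `S` at the keys `k`
and the published information. -/
def runExpectation
    (S : Matrix ((Bits K.m × Bits K.m) × (𝒜.Probe × Public K nz nx))
      ((Bits K.m × Bits K.m) × (𝒜.Probe × Public K nz nx)) ℂ)
    (k : Bits K.m × Bits K.m) (P : Partition n nz nx) (i iB : Bits (n + nz + nx)) : ℂ :=
  star (𝒜.eveVec P.bases i iB) ⬝ᵥ diagBlock S k (published K nz nx P i iB) *ᵥ
    𝒜.eveVec P.bases i iB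

variable (S : Matrix ((Bits K.m × Bits K.m) × (𝒜.Probe × Public K nz nx))
      ((Bits K.m × Bits K.m) × (𝒜.Probe × Public K nz nx)) ℂ)

theorem trace_mul_proj_kronecker_runState (k : Bits K.m × Bits K.m) (P : Partition n nz nx)
    (i iB : Bits (n + nz + nx)) :
    (S * (proj k ⊗ₖ runState K 𝒜 P i iB)).trace = runExpectation S k P i iB := by
  rw [runState, trace_mul_proj_kronecker, trace_mul_vecMulVec_star, runExpectation]

theorem norm_runExpectation_le (hS : ‖S‖ ≤ 1) (k : Bits K.m × Bits K.m) (P : Partition n nz nx)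
    (i iB : Bits (n + nz + nx)) :
    ‖runExpectation S k P i iB‖ ≤ 𝒜.outcomeProb P.bases i iB := by
  refine (norm_star_dotProduct_mulVec_le _ _ _).trans ?_
  rw [Real.mul_self_sqrt (normSq_nonneg _), ← 𝒜.outcomeProb_eq_normSq]
  exact mul_le_of_le_one_left (normSq_nonneg _) ((norm_diagBlock_le S _ _).trans hS)

theorem trace_mul_rhoABE_sub :
    (S * (rhoABE K nz nx pz px 𝒜 - rhoU K ⊗ₖ rhoE K nz nx pz px 𝒜)).trace =
      runWeight n nz nx * ∑ ω ∈ acceptedRuns pz px,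
        (runExpectation S (K.key (ω.1.info ω.2.1),
            K.bobKey (ω.1.info ω.2.2) (K.syndrome (ω.1.info ω.2.1))) ω.1 ω.2.1 ω.2.2 -
          (2 ^ K.m : ℂ)⁻¹ * ∑ κ, runExpectation S (κ, κ) ω.1 ω.2.1 ω.2.2) := by
  rw [rhoABE_eq, rhoU_kronecker_rhoE_eq, ← smul_sub, ← Finset.sum_sub_distrib]
  simp only [Matrix.mul_smul, Matrix.trace_smul, Matrix.mul_sum, Matrix.trace_sum, Matrix.mul_sub,
    Matrix.trace_sub, trace_mul_proj_kronecker_runState, smul_eq_mul]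

theorem norm_sum_runExpectation_bobKey_sub_le (hnz : 0 < nz) {ε : ℝ} (hε : 0 ≤ ε)
    (hK : K.CorrectsErrors (n * (pz + ε))) (hS : ‖S‖ ≤ 1) :
    ‖∑ ω ∈ acceptedRuns pz px,
      (runExpectation S (K.key (ω.1.info ω.2.1),
          K.bobKey (ω.1.info ω.2.2) (K.syndrome (ω.1.info ω.2.1))) ω.1 ω.2.1 ω.2.2 -
        runExpectation S (K.key (ω.1.info ω.2.1), K.key (ω.1.info ω.2.1)) ω.1 ω.2.1 ω.2.2)‖ ≤
      2 * 2 ^ (n + nz + nx) * (Real.exp (-2 * ((nz : ℝ) / (n + nz)) ^ 2 * n * ε ^ 2) *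
        Fintype.card (Partition n nz nx)) := by
  classical
  rw [mul_assoc]
  refine le_trans ?_ (mul_le_mul_of_nonneg_left
    (sum_outcomeProb_bobKey_ne_key_le (px := px) 𝒜 K hnz hε hK) zero_le_two)
  rw [Finset.mul_sum, Finset.sum_filter]
  refine norm_sum_le_of_le _ fun ω _ => ?_
  split_ifs with hne
  · rw [two_mul]
    exact norm_sub_le_of_le (norm_runExpectation_le S hS _ _ _ _)
      (norm_runExpectation_le S hS _ _ _ _)
  · rw [not_not.1 hne, sub_self, norm_zero]

theorem norm_sum_runExpectation_key_sub_le (hK : LinearIndependent (ZMod 2) K.rows)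
    (hnx : 0 < nx) {ε : ℝ} (hε : 0 ≤ ε) (hd : n * (px + ε) ≤ K.dist / 2) (hS : ‖S‖ ≤ 1) :
    ‖∑ ω ∈ acceptedRuns pz px,
      (runExpectation S (K.key (ω.1.info ω.2.1), K.key (ω.1.info ω.2.1)) ω.1 ω.2.1 ω.2.2 -
        (2 ^ K.m : ℂ)⁻¹ * ∑ κ, runExpectation S (κ, κ) ω.1 ω.2.1 ω.2.2)‖ ≤
      4 * 2 ^ (n + nz + nx) * (Real.exp (-((nx : ℝ) / (n + nx)) ^ 2 * n * ε ^ 2) *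
        Fintype.card (Partition n nz nx)) := by
  refine le_trans (le_of_eq ?_) (norm_sum_acceptedRuns_keyDefect_le (pz := pz) 𝒜 hK hnx hε hd
    fun κ w => (norm_diagBlock_le S (κ, κ) w).trans hS)
  refine congrArg norm (Finset.sum_congr rfl fun ω _ => ?_)
  rw [Code.keyDefect, Matrix.sub_mulVec, Matrix.smul_mulVec, Matrix.sum_mulVec, dotProduct_sub,
    dotProduct_smul, dotProduct_sum, smul_eq_mul]
  rfl

end State

theorem distanceFromIdeal_le {n nz nx : ℕ} (hnz : 0 < nz) (hnx : 0 < nx) (K : Code n)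
    (hK : LinearIndependent (ZMod 2) K.rows) {pz px εsec εrel : ℝ} (hεsec : 0 ≤ εsec)
    (hεrel : 0 ≤ εrel) (hd : n * (px + εsec) ≤ K.dist / 2)
    (hcorr : K.CorrectsErrors (n * (pz + εrel))) (𝒜 : CollectiveAttack (n + nz + nx)) :
    distanceFromIdeal K nz nx pz px 𝒜 ≤
      Real.exp (-2 * ((nz : ℝ) / (n + nz)) ^ 2 * n * εrel ^ 2) +
        2 * Real.exp (-((nx : ℝ) / (n + nx)) ^ 2 * n * εsec ^ 2) := by
  set X := Real.exp (-2 * ((nz : ℝ) / (n + nz)) ^ 2 * n * εrel ^ 2)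
  set Y := Real.exp (-((nx : ℝ) / (n + nx)) ^ 2 * n * εsec ^ 2)
  suffices h : distanceFromIdeal K nz nx pz px 𝒜 ≤ (2 * X + 4 * Y) / 2 by linarith
  refine traceDist_le_of_norm_trace_mul_le (isHermitian_rhoABE K pz px 𝒜)
    (isHermitian_rhoU_kronecker_rhoE K pz px 𝒜) fun S hS => ?_
  have hrel := norm_sum_runExpectation_bobKey_sub_le pz px S hnz hεrel hcorr hS
  have hsec := norm_sum_runExpectation_key_sub_le pz px S hK hnx hεsec hd hS
  have hsum := (norm_add_le _ _).trans (add_le_add hrel hsec)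
  simp only [← Finset.sum_add_distrib, sub_add_sub_cancel] at hsum
  rw [trace_mul_rhoABE_sub, norm_mul, Complex.norm_real,
    Real.norm_of_nonneg (runWeight_nonneg n nz nx)]
  calc
    _ ≤ _ := mul_le_mul_of_nonneg_left hsum (runWeight_nonneg n nz nx)
    _ = runWeight n nz nx *
        (2 ^ (n + nz + nx) * Fintype.card (Partition n nz nx)) * (2 * X + 4 * Y) := by
      ring
    _ ≤ _ := mul_le_of_le_one_left (by positivity) (runWeight_mul_le_one n nz nx)

/-! ### Exponential decay -/

theorem mul_exp_neg_le {b t : ℝ} (hb : 0 < b) :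
    t * Real.exp (-(b * t)) ≤ 2 / b * Real.exp (-(b / 2 * t)) := by
  have hexp : b / 2 * t ≤ Real.exp (b / 2 * t) := by linarith [Real.add_one_le_exp (b / 2 * t)]
  calc
    _ = 2 / b * (b / 2 * t * Real.exp (-(b * t))) := by field_simp
    _ ≤ 2 / b * (Real.exp (b / 2 * t) * Real.exp (-(b * t))) := by gcongr
    _ = _ := by
      rw [← Real.exp_add]
      ring_nf

theorem sq_div_add_le {c x y : ℝ} (hc : 0 < c) (hx : 0 < x) (hxy : c * x ≤ y) :
    (c / (1 + c)) ^ 2 ≤ (y / (x + y)) ^ 2 := by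
  have hy : 0 < y := (mul_pos hc hx).trans_le hxy
  gcongr ?_ ^ 2
  rw [div_le_div_iff₀ (by positivity) (by positivity)]
  linarith

theorem exists_exponential_bound {R εrel εsec c : ℝ} (hR : 0 < R) (hεrel : 0 < εrel)
    (hεsec : 0 < εsec) (hc : 0 < c) :
    ∃ C κ : ℝ, 0 < C ∧ 0 < κ ∧ ∀ x y z : ℝ, 0 < x → c * x ≤ y → c * x ≤ z →
      Real.exp (-2 * (y / (x + y)) ^ 2 * x * εrel ^ 2) +
          2 * R * x * Real.exp (-(z / (x + z)) ^ 2 * x * εsec ^ 2) ≤ C * Real.exp (-κ * x) := by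
  set g := (c / (1 + c)) ^ 2
  set a := 2 * g * εrel ^ 2
  set b := g * εsec ^ 2
  have : 0 < a := by positivity
  have hb0 : 0 < b := by positivity
  refine ⟨1 + 4 * R / b, min a (b / 2), by positivity, by positivity, fun x y z hx hy hz => ?_⟩
  have hrel : Real.exp (-2 * (y / (x + y)) ^ 2 * x * εrel ^ 2) ≤
      Real.exp (-min a (b / 2) * x) := by
    have hfrac := mul_le_mul_of_nonneg_right (sq_div_add_le hc hx hy)
      (by positivity : 0 ≤ x * εrel ^ 2)
    have hmin := mul_le_mul_of_nonneg_right (min_le_left a (b / 2)) hx.le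
    exact Real.exp_le_exp.2 (by linarith)
  have hsec : x * Real.exp (-(z / (x + z)) ^ 2 * x * εsec ^ 2) ≤
      2 / b * Real.exp (-min a (b / 2) * x) := by
    have hfrac := mul_le_mul_of_nonneg_right (sq_div_add_le hc hx hz)
      (by positivity : 0 ≤ x * εsec ^ 2)
    have hmin := mul_le_mul_of_nonneg_right (min_le_right a (b / 2)) hx.le
    calc
      _ ≤ x * Real.exp (-(b * x)) := by
        gcongr
        linarith
      _ ≤ 2 / b * Real.exp (-(b / 2 * x)) := mul_exp_neg_le hb0
      _ ≤ _ := by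
        gcongr
        linarith
  calc
    _ ≤ Real.exp (-min a (b / 2) * x) + 2 * R * (2 / b * Real.exp (-min a (b / 2) * x)) := by
      rw [mul_assoc (2 * R)]
      gcongr
    _ = _ := by ring

end BB84InfoZ

end

theorem mainTheorem1
    (δ R : ℝ) (hδ : 0 < δ) (hR : 0 < R)
    (S : Set ℕ) (K : ∀ n : ℕ, BB84InfoZ.Code n)
    (hindep : ∀ n ∈ S, LinearIndependent (ZMod 2) (K n).rows)
    (hdist : ∀ n ∈ S, δ < ((K n).dist : ℝ) / n)
    (hrate : ∀ n ∈ S, ((K n).m : ℝ) / n ≤ R)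
    (pz px εsec εrel : ℝ) (hpz : 0 < pz) (hpx : 0 < px) (hεsec : 0 < εsec) (hεrel : 0 < εrel)
    (hpx_le : px + εsec ≤ δ / 2)
    (hcorr : ∀ n ∈ S, (K n).CorrectsErrors (n * (pz + εrel))) :
    (∀ n ∈ S, ∀ nz nx : ℕ, 0 < n → 0 < nz → 0 < nx →
      ∀ 𝒜 : BB84InfoZ.CollectiveAttack (n + nz + nx),
        BB84InfoZ.distanceFromIdeal (K n) nz nx pz px 𝒜 ≤
          Real.exp (-2 * ((nz : ℝ) / (n + nz)) ^ 2 * n * εrel ^ 2) +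
            2 * R * n * Real.exp (-((nx : ℝ) / (n + nx)) ^ 2 * n * εsec ^ 2)) ∧
    (∀ c : ℝ, 0 < c → ∃ C κ : ℝ, 0 < C ∧ 0 < κ ∧
      (∀ n nz nx : ℕ, 0 < n → 0 < nz → 0 < nx → c * n ≤ nz → c * n ≤ nx →
        Real.exp (-2 * ((nz : ℝ) / (n + nz)) ^ 2 * n * εrel ^ 2) +
            2 * R * n * Real.exp (-((nx : ℝ) / (n + nx)) ^ 2 * n * εsec ^ 2) ≤
          C * Real.exp (-κ * n)) ∧
      (∀ n ∈ S, ∀ nz nx : ℕ, 0 < n → 0 < nz → 0 < nx → c * n ≤ nz → c * n ≤ nx →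
        ∀ 𝒜 : BB84InfoZ.CollectiveAttack (n + nz + nx),
          BB84InfoZ.distanceFromIdeal (K n) nz nx pz px 𝒜 ≤ C * Real.exp (-κ * n))) := by
  have hbound : ∀ n ∈ S, ∀ nz nx : ℕ, 0 < n → 0 < nz → 0 < nx →
      ∀ 𝒜 : BB84InfoZ.CollectiveAttack (n + nz + nx),
        BB84InfoZ.distanceFromIdeal (K n) nz nx pz px 𝒜 ≤
          Real.exp (-2 * ((nz : ℝ) / (n + nz)) ^ 2 * n * εrel ^ 2) +
            2 * R * n * Real.exp (-((nx : ℝ) / (n + nx)) ^ 2 * n * εsec ^ 2) := by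
    intro n hn nz nx hn0 hnz hnx 𝒜
    have hn0' : (0 : ℝ) < n := Nat.cast_pos.2 hn0
    have hdn : n * δ < (K n).dist := (lt_div_iff₀' hn0').1 (hdist n hn)
    have hm : (1 : ℝ) ≤ (K n).m := Nat.one_le_cast.2 <|
      (K n).m_pos_of_dist_pos (Nat.cast_pos.1 ((mul_pos hn0' hδ).trans hdn))
    have hRn : 1 ≤ R * n := hm.trans ((div_le_iff₀ hn0').1 (hrate n hn))
    have hd : n * (px + εsec) ≤ (K n).dist / 2 := by
      linarith [mul_le_mul_of_nonneg_left hpx_le hn0'.le]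
    refine (BB84InfoZ.distanceFromIdeal_le hnz hnx (K n) (hindep n hn) hεsec.le hεrel.le hd
      (hcorr n hn) 𝒜).trans ?_
    rw [mul_assoc 2 R]
    gcongr
    linarith
  refine ⟨hbound, fun c hc => ?_⟩
  obtain ⟨C, κ, hC, hκ, hdecay⟩ := BB84InfoZ.exists_exponential_bound hR hεrel hεsec hc
  exact ⟨C, κ, hC, hκ, fun n nz nx hn _ _ hz hx => hdecay n nz nx (Nat.cast_pos.2 hn) hz hx,
    fun n hn nz nx hn0 hnz hnx hz hx 𝒜 => (hbound n hn nz nx hn0 hnz hnx 𝒜).trans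
      (hdecay n nz nx (Nat.cast_pos.2 hn0) hz hx)⟩
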